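/- Let $n\ge 0$ be an integer, let $J=\begin{pmatrix}0&-I\\ I&0\end{pmatrix}\in\mathbb C^{2n\times 2n}$, and let $H:(0,\infty)\to\mathbb C^{2n\times 2n}$ be locally integrable with $H(x)\ge 0$ for almost every $x$. Let $L^2_H(0,\infty)$ be the space of measurable $f:(0,\infty)\to\mathbb C^{2n}$ with $\int_0^\infty f^*Hf\,dx<\infty$, modulo those with $\int_0^\infty f^*Hf\,dx=0$, and let $\mathcal T\subset L^2_H(0,\infty)\oplus L^2_H(0,\infty)$ be the maximal relation, consisting of all pairs $(f,g)$ such that $f$ has a locally absolutely continuous representative $f_0$ with $Jf_0'=-Hg$ almost everywhere. Assume that 1. the endpoint $0$ is regular, i.e. $H\in L^1(0,c)$ for some $c>0$; 2. $H$ is definite on $(0,\infty)$, i.e. if $w\in\mathbb C^{2n}$ and $H(x)w=0$ for almost every $x>0$, then $w=0$; 3. both deficiency indices $\dim\ker(\mathcal T-i)$ and $\dim\ker(\mathcal T+i)$ are equal to $n$. Let $\alpha\in\mathbb C^{n\times 2n}$ satisfy $\alpha\alpha^*=I$ and $\alpha J\alpha^*=0$. For $z\in\mathbb C$ let $u(\cdot,z),v(\cdot,z):[0,\infty)\to\mathbb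 C^{2n\times n}$ be the solutions (absolutely continuous on every $[0,b]$) of $Jy'=-zHy$ with $u(0,z)=-J\alpha^*$ and $v(0,z)=\alpha^*$. Then for every $z\in\mathbb C\setminus\mathbb R$ there is a unique matrix $m(z)\in\mathbb C^{n\times n}$ such that all columns of $v(\cdot,z)+u(\cdot,z)m(z)$ are in $L^2_H(0,\infty)$, and the matrix-valued function $m$ so defined (the half-line Weyl function) is holomorphic on $\mathbb C\setminus\mathbb R$. -/

import Mathlib

open MeasureTheory Set Matrix
open scoped ComplexOrder ENNReal

/-- The coefficient of a canonical system `J u' = -z H u` of order `2n` on the half line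
`(0, ∞)`: a locally integrable function with values in the `2n × 2n` complex matrices,
`H x ≥ 0` for almost every `x > 0`. Values at `x ≤ 0` are irrelevant. -/
structure HalfLineSystem (n : ℕ) where
  H : ℝ → Matrix (Fin n ⊕ Fin n) (Fin n ⊕ Fin n) ℂ
  locallyIntegrable : ∀ i j, LocallyIntegrableOn (fun x => H x i j) (Ioi 0) volume
  posSemidef : ∀ᵐ x ∂volume.restrict (Ioi (0 : ℝ)), (H x).PosSemidef

namespace HalfLineSystem

variable {n : ℕ} (S : HalfLineSystem n)

/-- The endpoint `0` is regular: `H ∈ L¹(0, c)` for some `c > 0`. -/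
def RegularAtZero : Prop :=
  ∃ c : ℝ, 0 < c ∧ ∀ i j, IntegrableOn (fun x => S.H x i j) (Ioo 0 c) volume

/-- `H` is definite on `(0, ∞)`. -/
def IsDefinite : Prop :=
  ∀ w : Fin n ⊕ Fin n → ℂ,
    (∀ᵐ x ∂volume.restrict (Ioi (0 : ℝ)), S.H x *ᵥ w = 0) → w = 0

/-- The density `f(x)* H(x) f(x)` (which is real and nonnegative for almost every `x > 0`). -/
noncomputable def energyDensity (f : ℝ → Fin n ⊕ Fin n → ℂ) (x : ℝ) : ℝ≥0∞ :=
  ENNReal.ofReal (star (f x) ⬝ᵥ (S.H x *ᵥ f x)).re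

/-- The squared seminorm `∫₀^∞ f(x)* H(x) f(x) dx`, as an element of `[0, ∞]`. -/
noncomputable def energy (f : ℝ → Fin n ⊕ Fin n → ℂ) : ℝ≥0∞ :=
  ∫⁻ x in Ioi (0 : ℝ), S.energyDensity f x

theorem aemeasurable_energyDensity {f : ℝ → Fin n ⊕ Fin n → ℂ}
    (hf : AEMeasurable f (volume.restrict (Ioi 0))) :
    AEMeasurable (S.energyDensity f) (volume.restrict (Ioi 0)) := by
  have hH : ∀ i j, AEMeasurable (fun x => S.H x i j) (volume.restrict (Ioi (0 : ℝ))) :=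
    fun i j => (S.locallyIntegrable i j).aestronglyMeasurable.aemeasurable
  have hfi : ∀ i, AEMeasurable (fun x => f x i) (volume.restrict (Ioi (0 : ℝ))) :=
    fun i => aemeasurable_pi_iff.1 hf i
  unfold energyDensity
  refine ENNReal.measurable_ofReal.comp_aemeasurable
    (Complex.measurable_re.comp_aemeasurable ?_)
  simp only [dotProduct, mulVec, Pi.star_apply]
  refine Finset.aemeasurable_fun_sum _ fun i _ => ?_
  refine ((continuous_star.measurable).comp_aemeasurable (hfi i)).mul ?_
  exact Finset.aemeasurable_fun_sum _ fun j _ => (hH i j).mul (hfi j)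

theorem energyDensity_add_le (f g : ℝ → Fin n ⊕ Fin n → ℂ) {x : ℝ}
    (hx : (S.H x).PosSemidef) :
    S.energyDensity (f + g) x ≤ 2 * S.energyDensity f x + 2 * S.energyDensity g x := by
  have q : ∀ w : Fin n ⊕ Fin n → ℂ, 0 ≤ (star w ⬝ᵥ (S.H x *ᵥ w)).re := fun w =>
    (Complex.le_def.1 (hx.dotProduct_mulVec_nonneg w)).1
  have hsub := q (f x - g x)
  have h2 : (2 : ℝ≥0∞) = ENNReal.ofReal 2 := by simp
  unfold energyDensity
  rw [h2, ← ENNReal.ofReal_mul (by norm_num), ← ENNReal.ofReal_mul (by norm_num),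
    ← ENNReal.ofReal_add (mul_nonneg (by norm_num) (q _)) (mul_nonneg (by norm_num) (q _))]
  apply ENNReal.ofReal_le_ofReal
  simp only [Pi.add_apply, star_add, star_sub, mulVec_add, mulVec_sub, add_dotProduct,
    sub_dotProduct, dotProduct_add, dotProduct_sub, Complex.add_re, Complex.sub_re] at hsub ⊢
  linarith

theorem energyDensity_smul (c : ℂ) (f : ℝ → Fin n ⊕ Fin n → ℂ) (x : ℝ) :
    S.energyDensity (c • f) x = ENNReal.ofReal (‖c‖ ^ 2) * S.energyDensity f x := by
  unfold energyDensity
  rw [← ENNReal.ofReal_mul (by positivity)]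
  congr 1
  simp only [Pi.smul_apply, star_smul, mulVec_smul, smul_dotProduct, dotProduct_smul,
    smul_eq_mul, ← mul_assoc]
  have : c * star c = ((‖c‖ ^ 2 : ℝ) : ℂ) := by
    rw [Complex.star_def, Complex.mul_conj']
    push_cast
    rfl
  rw [this, Complex.re_ofReal_mul]

theorem energy_zero : S.energy 0 = 0 := by
  simp [energy, energyDensity]

theorem energy_add_le {f g : ℝ → Fin n ⊕ Fin n → ℂ}
    (hf : AEMeasurable f (volume.restrict (Ioi 0))) :
    S.energy (f + g) ≤ 2 * S.energy f + 2 * S.energy g := by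
  unfold energy
  calc ∫⁻ x in Ioi (0 : ℝ), S.energyDensity (f + g) x
      ≤ ∫⁻ x in Ioi (0 : ℝ), (2 * S.energyDensity f x + 2 * S.energyDensity g x) :=
        lintegral_mono_ae (S.posSemidef.mono fun x hx => S.energyDensity_add_le f g hx)
    _ = _ := by
        rw [lintegral_add_left' ((S.aemeasurable_energyDensity hf).const_mul 2),
          lintegral_const_mul' _ _ (by simp), lintegral_const_mul' _ _ (by simp)]

theorem energy_smul (c : ℂ) (f : ℝ → Fin n ⊕ Fin n → ℂ) :
    S.energy (c • f) = ENNReal.ofReal (‖c‖ ^ 2) * S.energy f := by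
  unfold energy
  simp only [energyDensity_smul]
  rw [lintegral_const_mul' _ _ (by simp)]

/-- The space of measurable `f : (0, ∞) → ℂ²ⁿ` with `∫₀^∞ f* H f dx < ∞`. -/
def preL2 : Submodule ℂ (ℝ → Fin n ⊕ Fin n → ℂ) where
  carrier := {f | AEMeasurable f (volume.restrict (Ioi 0)) ∧ S.energy f < ∞}
  zero_mem' := ⟨aemeasurable_const, by simp [energy_zero]⟩
  add_mem' := fun {f g} hf hg => ⟨hf.1.add hg.1, (S.energy_add_le hf.1).trans_lt
    (ENNReal.add_lt_top.2
      ⟨ENNReal.mul_lt_top (by simp) hf.2, ENNReal.mul_lt_top (by simp) hg.2⟩)⟩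
  smul_mem' := fun c f hf => ⟨hf.1.const_smul c, by
    rw [energy_smul]
    exact ENNReal.mul_lt_top (by simp) hf.2⟩

/-- The elements of seminorm zero. -/
def nullSpace : Submodule ℂ S.preL2 where
  carrier := {f | S.energy f = 0}
  zero_mem' := S.energy_zero
  add_mem' := fun {f g} hf hg => by
    have h := S.energy_add_le (g := g) f.2.1
    simp only [mem_ofPred_eq] at hf hg
    rw [hf, hg] at h
    simpa using h
  smul_mem' := fun c f hf => by
    simp only [mem_ofPred_eq] at hf
    have h := S.energy_smul c f
    rw [hf, mul_zero] at h
    simpa using h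

/-- The space `L²_H(0, ∞)`. -/
abbrev L2 : Type := S.preL2 ⧸ S.nullSpace

/-- `f` is locally absolutely continuous on `(0, ∞)`. -/
def LocallyAC (f : ℝ → Fin n ⊕ Fin n → ℂ) : Prop :=
  ∀ a b : ℝ, 0 < a → a ≤ b → AbsolutelyContinuousOnInterval f a b

/-- `J f' = -H g` almost everywhere on `(0, ∞)`, with `J = !![0, -1; 1, 0]`. -/
def SolvesAE (f g : ℝ → Fin n ⊕ Fin n → ℂ) : Prop :=
  ∀ᵐ x ∂volume.restrict (Ioi (0 : ℝ)),
    ∃ d, HasDerivAt f d x ∧ Matrix.J (Fin n) ℂ *ᵥ d = -(S.H x *ᵥ g x)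

/-- The maximal relation of the canonical system. -/
def maximalRelation : Submodule ℂ (S.L2 × S.L2) where
  carrier := {p | ∃ f g : S.preL2, S.nullSpace.mkQ f = p.1 ∧ S.nullSpace.mkQ g = p.2 ∧
    LocallyAC (f : ℝ → Fin n ⊕ Fin n → ℂ) ∧ S.SolvesAE f g}
  zero_mem' := by
    refine ⟨0, 0, by simp, by simp, fun a b _ _ => ?_, ?_⟩
    · have h := (LipschitzWith.const (0 : Fin n ⊕ Fin n → ℂ)).lipschitzOnWith
        (s := uIcc a b) |>.absolutelyContinuousOnInterval
      exact h
    · exact Filter.Eventually.of_forall fun x => ⟨0, hasDerivAt_const x _, by simp⟩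
  add_mem' := by
    rintro p q ⟨f, g, hf, hg, hac, hs⟩ ⟨f', g', hf', hg', hac', hs'⟩
    refine ⟨f + f', g + g', by simp [← hf, ← hf'], by simp [← hg, ← hg'],
      fun a b ha hb => (hac a b ha hb).add (hac' a b ha hb), ?_⟩
    filter_upwards [hs, hs'] with x hx hx'
    obtain ⟨d, hd, he⟩ := hx
    obtain ⟨d', hd', he'⟩ := hx'
    refine ⟨d + d', hd.add hd', ?_⟩
    rw [mulVec_add, he, he', Submodule.coe_add, Pi.add_apply, mulVec_add, neg_add]
  smul_mem' := by
    rintro c p ⟨f, g, hf, hg, hac, hs⟩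
    refine ⟨c • f, c • g, by simp [← hf], by simp [← hg],
      fun a b ha hb => (hac a b ha hb).const_smul c, ?_⟩
    filter_upwards [hs] with x hx
    obtain ⟨d, hd, he⟩ := hx
    refine ⟨c • d, hd.const_smul c, ?_⟩
    rw [mulVec_smul, he, Submodule.coe_smul, Pi.smul_apply, mulVec_smul, smul_neg]

/-- `ker (T - z) = {f : (f, z f) ∈ T}` for the maximal relation `T`. -/
def maximalKer (z : ℂ) : Submodule ℂ S.L2 :=
  S.maximalRelation.comap (LinearMap.prod LinearMap.id (z • LinearMap.id))

/-- Both deficiency indices, `dim ker (T - i)` and `dim ker (T + i)`, are equal to `k`. -/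
def DeficiencyIndicesEq (k : ℕ) : Prop :=
  Module.rank ℂ (S.maximalKer Complex.I) = k ∧ Module.rank ℂ (S.maximalKer (-Complex.I)) = k

/-- `U` is a matrix solution of `J U' = -z H U` with `U(0) = C`: its columns are absolutely
continuous on every interval `[0, b]` and solve the equation almost everywhere. -/
def IsMatrixSolution (z : ℂ) (C : Matrix (Fin n ⊕ Fin n) (Fin n) ℂ)
    (U : ℝ → Matrix (Fin n ⊕ Fin n) (Fin n) ℂ) : Prop :=
  U 0 = C ∧ ∀ j, (∀ b : ℝ, 0 ≤ b → AbsolutelyContinuousOnInterval (fun x i => U x i j) 0 b) ∧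
    S.SolvesAE (fun x i => U x i j) (fun x i => z * U x i j)

/-- The matrix `M` has the defining property of the Weyl matrix `m(z)` for the boundary condition
`α` at `0`: the columns of `v(·, z) + u(·, z) M` are in `L²_H(0, ∞)`, where `u` and `v` are the
solutions with `u(0, z) = -J α*` and `v(0, z) = α*`. -/
def IsWeylMatrix (α : Matrix (Fin n) (Fin n ⊕ Fin n) ℂ) (z : ℂ)
    (M : Matrix (Fin n) (Fin n) ℂ) : Prop :=
  ∃ u v : ℝ → Matrix (Fin n ⊕ Fin n) (Fin n) ℂ,
    S.IsMatrixSolution z (-(Matrix.J (Fin n) ℂ * αᴴ)) u ∧ S.IsMatrixSolution z αᴴ v ∧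
    ∀ j, (fun x i => (v x + u x * M) i j) ∈ S.preL2

open Classical in
/-- The half-line Weyl function `m`; the value `0` is used where no Weyl matrix exists. -/
noncomputable def weylM (α : Matrix (Fin n) (Fin n ⊕ Fin n) ℂ) (z : ℂ) :
    Matrix (Fin n) (Fin n) ℂ :=
  if h : ∃ M, S.IsWeylMatrix α z M then h.choose else 0

end HalfLineSystem

/-! Weyl's nested-interval argument. On `(0, b]` impose `α y(b) = 0`; this determines a matrix
`finiteWeyl` `M_b(z)`, holomorphic off the real axis, because a nontrivial solution satisfying the
condition at both ends would be an eigenfunction of a self-adjoint problem with nonreal eigenvalue.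
For the `j`-th column `y` of `v + u M_b`, the Lagrange identity (`Solves.lagrange`) gives `Im z ·
‖y‖² = Im (M_b)_jj`, the norm being taken over `(0, b]`. Since `‖y‖²` dominates `δ ‖y(0)‖²`
(`exists_le_nsq_trunc_sol`), while `M_b` depends affinely on the initial values through `α J`, the
`M_b` are bounded, locally uniformly in `z` (`finiteWeyl_bounds`). The norms `‖y‖` are bounded as
well, so every cluster point of `M_b` as `b → ∞` is a Weyl matrix.

Uniqueness needs the space of square-integrable solutions to have dimension at most `n`
(`isWeylMatrix_unique`): the columns of `v + u M` are independent and then span it, and `α (v + u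
M)(0) = 1` fixes the basis. Hence `M_b(z)` has a single cluster point and converges; a locally
bounded pointwise limit of holomorphic functions is holomorphic.

The hypotheses bound this dimension only at `±i`. It is carried over to all nonreal `z` by showing
that the dimension at `z` is at most that at `z₀` whenever `|z - z₀| < |Im z₀|`
(`finrank_l2Initial_le`), followed by connectedness of the half-planes. Otherwise some nonzero
solution `y` at `z` would be orthogonal to all square-integrable solutions at `z₀`. On `(0, b]`,
subtract from `y` its projection onto the solutions at `z₀`; the remainder `e` lies in the range of
the minimal relation minus `z₀*` (the conjugate), and symmetry of that relation gives `|Im z₀| ‖e‖ ≤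
|z - z₀| ‖y‖`. As `b → ∞` the projections tend to `0`, so `e` tends to `y`, a contradiction. -/

/-! ### Absolutely continuous functions -/

open Filter Topology in
/-- A function whose increments are dominated by those of an absolutely continuous function is
absolutely continuous. -/
theorem AbsolutelyContinuousOnInterval.of_dist_le {X Y : Type*} [PseudoMetricSpace X]
    [PseudoMetricSpace Y] {f : ℝ → X} {g : ℝ → Y} {a b : ℝ}
    (hf : AbsolutelyContinuousOnInterval f a b) (K : ℝ)
    (h : ∀ x ∈ uIcc a b, ∀ y ∈ uIcc a b, dist (g x) (g y) ≤ K * dist (f x) (f y)) :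
    AbsolutelyContinuousOnInterval g a b := by
  unfold AbsolutelyContinuousOnInterval at *
  have h0 := hf.const_mul K
  rw [mul_zero] at h0
  refine squeeze_zero' (Eventually.of_forall fun E => Finset.sum_nonneg fun i _ => dist_nonneg)
    ?_ h0
  refine eventually_inf_principal.2 (Eventually.of_forall fun E hE => ?_)
  rw [Finset.mul_sum]
  exact Finset.sum_le_sum fun i hi => h _ (hE.1 i hi).1 _ (hE.1 i hi).2

theorem AbsolutelyContinuousOnInterval.apply {ι : Type*} [Fintype ι] {f : ℝ → ι → ℂ} {a b : ℝ}
    (hf : AbsolutelyContinuousOnInterval f a b) (i : ι) :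
    AbsolutelyContinuousOnInterval (fun x => f x i) a b :=
  hf.of_dist_le 1 fun x _ y _ => by rw [one_mul]; exact dist_le_pi_dist _ _ _

theorem AbsolutelyContinuousOnInterval.const {X : Type*} [PseudoMetricSpace X] (c : X) (a b : ℝ) :
    AbsolutelyContinuousOnInterval (fun _ => c) a b :=
  (LipschitzWith.const c).lipschitzOnWith.absolutelyContinuousOnInterval

theorem AbsolutelyContinuousOnInterval.sum {ι F : Type*} [SeminormedAddCommGroup F]
    (s : Finset ι) {f : ι → ℝ → F} {a b : ℝ}
    (hf : ∀ i ∈ s, AbsolutelyContinuousOnInterval (f i) a b) :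
    AbsolutelyContinuousOnInterval (fun x => ∑ i ∈ s, f i x) a b := by
  classical
  induction s using Finset.induction_on with
  | empty => simpa using AbsolutelyContinuousOnInterval.const (0 : F) a b
  | insert i s hi ih =>
    simp only [Finset.sum_insert hi]
    exact (hf i (Finset.mem_insert_self i s)).add
      (ih fun j hj => hf j (Finset.mem_insert_of_mem hj))

/-- Dot products of absolutely continuous functions are absolutely continuous. -/
theorem AbsolutelyContinuousOnInterval.dotProduct {ι : Type*} [Fintype ι] {f g : ℝ → ι → ℂ}
    {a b : ℝ} (hf : AbsolutelyContinuousOnInterval f a b)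
    (hg : AbsolutelyContinuousOnInterval g a b) :
    AbsolutelyContinuousOnInterval (fun x => f x ⬝ᵥ g x) a b :=
  AbsolutelyContinuousOnInterval.sum _ fun i _ => (hf.apply i).smul (hg.apply i)

/-- A primitive of an integrable function is absolutely continuous. -/
theorem IntervalIntegrable.absolutelyContinuousOnInterval_primitive {E : Type*}
    [NormedAddCommGroup E] [NormedSpace ℝ E] {f : ℝ → E} {a b c : ℝ}
    (h : IntervalIntegrable f volume a b) (hc : c ∈ uIcc a b) :
    AbsolutelyContinuousOnInterval (fun x => ∫ t in c..x, f t) a b := by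
  have hi : ∀ x ∈ uIcc a b, ∀ y ∈ uIcc a b, IntervalIntegrable f volume x y := fun x hx y hy =>
    h.mono_set (uIcc_subset_uIcc hx hy)
  refine (h.norm.absolutelyContinuousOnInterval_intervalIntegral hc).of_dist_le 1
    fun x hx y hy => ?_
  rw [one_mul, dist_eq_norm, Real.dist_eq,
    intervalIntegral.integral_interval_sub_left (hi c hc x hx) (hi c hc y hy),
    intervalIntegral.integral_interval_sub_left (hi c hc x hx).norm (hi c hc y hy).norm]
  exact intervalIntegral.norm_integral_le_abs_integral_norm

/-- The fundamental theorem of calculus for absolutely continuous vector-valued functions. -/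
theorem AbsolutelyContinuousOnInterval.integral_eq_sub_of_ae_hasDerivAt {E : Type*}
    [NormedAddCommGroup E] [NormedSpace ℝ E] [CompleteSpace E] {f f' : ℝ → E} {a b : ℝ}
    (hf : AbsolutelyContinuousOnInterval f a b)
    (hd : ∀ᵐ x, x ∈ uIoc a b → HasDerivAt f (f' x) x)
    (hi : IntervalIntegrable f' volume a b) : ∫ x in a..b, f' x = f b - f a := by
  -- Subtracting the primitive of `f'` leaves an absolutely continuous function with derivative zero
  -- almost everywhere, hence a constant.
  have hac := hf.sub (hi.absolutelyContinuousOnInterval_primitive (c := a) left_mem_uIcc)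
  -- The half-open interval in `hd` omits the left endpoint, a null set.
  have ha : ∀ᵐ x : ℝ, x ≠ min a b := by simp [ae_iff, measure_singleton]
  obtain ⟨C, hC⟩ := hac.const_of_ae_hasDerivAt_zero (by
    filter_upwards [hd, hi.ae_hasDerivAt_integral, ha] with x h1 h2 h3 hx
    have hx' : x ∈ uIoc a b := ⟨lt_of_le_of_ne hx.1 h3.symm, hx.2⟩
    simpa using (h1 hx').sub (h2 hx a left_mem_uIcc))
  have h1 := hC a left_mem_uIcc
  have h2 := hC b right_mem_uIcc
  simp only [Pi.sub_apply, intervalIntegral.integral_same, sub_zero] at h1 h2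
  rw [h1, ← h2]
  abel

/-! ### Bounded limits of holomorphic functions -/

open Filter Topology in
/-- A bounded pointwise limit of holomorphic functions on a disc is holomorphic. -/
theorem differentiableOn_ball_of_tendsto_of_bounded {F : ℕ → ℂ → ℂ} {f : ℂ → ℂ} {c : ℂ} {R C : ℝ}
    (hR : 0 < R) (hF : ∀ k, DifferentiableOn ℂ (F k) (Metric.closedBall c R))
    (hb : ∀ k, ∀ z ∈ Metric.closedBall c R, ‖F k z‖ ≤ C)
    (hl : ∀ z ∈ Metric.closedBall c R, Tendsto (fun k => F k z) atTop (𝓝 (f z))) :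
    DifferentiableOn ℂ f (Metric.ball c R) := by
  have hmem : ∀ θ, circleMap c R θ ∈ Metric.closedBall c R := circleMap_mem_closedBall c hR.le
  have hFc : ∀ k, Continuous fun θ => F k (circleMap c R θ) := fun k =>
    (hF k).continuousOn.comp_continuous (continuous_circleMap c R) hmem
  have hfm : AEStronglyMeasurable (fun θ => f (circleMap c R θ)) volume :=
    aestronglyMeasurable_of_tendsto_ae atTop (fun k => (hFc k).aestronglyMeasurable)
      (ae_of_all _ fun θ => hl _ (hmem θ))
  have hfb : ∀ z ∈ Metric.closedBall c R, ‖f z‖ ≤ C := fun z hz =>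
    le_of_tendsto (hl z hz).norm (Eventually.of_forall fun k => hb k z hz)
  have hci : CircleIntegrable f c R := by
    refine (intervalIntegrable_const (c := C)).mono_fun hfm.restrict (ae_of_all _ fun θ => ?_)
    exact (hfb _ (hmem θ)).trans (le_abs_self C)
  lift R to NNReal using hR.le
  -- The Cauchy integral of the merely bounded measurable boundary function `f` is already
  -- holomorphic; it remains to identify it with `f` by passing to the limit in Cauchy's formula for
  -- `F k`.
  have hp := (hasFPowerSeriesOn_cauchy_integral hci (by exact_mod_cast hR)).differentiableOn
  rw [Metric.eball_coe] at hp
  refine hp.congr fun w hw => ?_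
  refine tendsto_nhds_unique (hl w (Metric.ball_subset_closedBall hw)) ?_
  have h1 : ∀ k, F k w =
      (2 * Real.pi * Complex.I : ℂ)⁻¹ • ∮ z in C(c, R), (z - w)⁻¹ • F k z := fun k =>
    ((hF k).circleIntegral_sub_inv_smul hw ▸ by
      rw [smul_smul, inv_mul_cancel₀ Complex.two_pi_I_ne_zero, one_smul])
  simp only [h1]
  refine Tendsto.const_smul ?_ _
  -- The distance from `w` to the circle keeps the Cauchy kernel bounded, which gives a constant
  -- dominating function.
  have hw' : 0 < R - dist w c := sub_pos.2 hw
  have hne : ∀ θ, (R : ℝ) - dist w c ≤ ‖circleMap c R θ - w‖ := fun θ => by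
    have h := dist_triangle (circleMap c R θ) w c
    have h2 : dist (circleMap c R θ) c = R := circleMap_mem_sphere c hR.le θ
    rw [← dist_eq_norm]
    linarith
  have hinv : Continuous fun θ => (circleMap c R θ - w)⁻¹ :=
    ((continuous_circleMap c R).sub continuous_const).inv₀ fun θ h => by
      have h0 := hne θ
      rw [show circleMap c R θ - w = 0 from h, norm_zero] at h0
      linarith
  refine intervalIntegral.tendsto_integral_filter_of_dominated_convergence
    (fun _ => R * ((R - dist w c)⁻¹ * C)) (Eventually.of_forall fun k => ?_)
    (Eventually.of_forall fun k => ae_of_all _ fun θ _ => ?_) intervalIntegrable_const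
    (ae_of_all _ fun θ _ => ?_)
  · refine Continuous.aestronglyMeasurable ?_
    simp only [deriv_circleMap]
    exact ((continuous_circleMap 0 R).mul continuous_const).smul (hinv.smul (hFc k))
  · simp only [norm_smul, deriv_circleMap, norm_mul, Complex.norm_I, mul_one, norm_circleMap_zero,
      norm_inv, NNReal.abs_eq]
    gcongr
    · exact hne θ
    · exact hb k _ (hmem θ)
  · exact ((hl _ (hmem θ)).const_smul _).const_smul _

/-! ### The fundamental solution as a power series in the spectral parameter -/

section Propagator

variable {𝔸 : Type*} [NormedRing 𝔸] [NormedAlgebra ℂ 𝔸]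

/-- The coefficients of the power series of the solution of `Y' = z A Y`, `Y 0 = 1`. -/
noncomputable def propagatorCoeff (A : ℝ → 𝔸) : ℕ → ℝ → 𝔸
  | 0 => fun _ => 1
  | k + 1 => fun x => ∫ t in (0 : ℝ)..x, A t * propagatorCoeff A k t

/-- The solution of `Y' = z A Y`, `Y 0 = 1`. -/
noncomputable def propagator (A : ℝ → 𝔸) (z : ℂ) (x : ℝ) : 𝔸 :=
  ∑' k, z ^ k • propagatorCoeff A k x

/-- A bound for the norms of the terms of the series `propagator A z x` if `‖z‖ ≤ r` and
`0 ≤ x ≤ b`. -/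
noncomputable def propagatorBound (A : ℝ → 𝔸) (r b : ℝ) (k : ℕ) : ℝ :=
  ‖(1 : 𝔸)‖ * ((r * ∫ t in (0 : ℝ)..b, ‖A t‖) ^ k / k.factorial)

variable {A : ℝ → 𝔸}

theorem continuous_propagatorCoeff (hA : ∀ a b, IntervalIntegrable A volume a b) (k : ℕ) :
    Continuous (propagatorCoeff A k) := by
  induction k with
  | zero => exact continuous_const
  | succ k ih =>
    exact intervalIntegral.continuous_primitive
      (fun a b => (hA a b).mul_continuousOn ih.continuousOn) 0

/-- The usual iterated-integral formula. Since `h` is only integrable, the chain rule holds almost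
everywhere and absolute continuity of the powers of the primitive is needed to integrate it. -/
theorem integral_mul_primitive_pow {h : ℝ → ℝ} (hh : ∀ a b, IntervalIntegrable h volume a b)
    (k : ℕ) (x : ℝ) :
    ∫ t in (0 : ℝ)..x, h t * ((∫ s in (0 : ℝ)..t, h s) ^ k / k.factorial) =
      (∫ s in (0 : ℝ)..x, h s) ^ (k + 1) / (k + 1).factorial := by
  set Φ : ℝ → ℝ := fun t => ∫ s in (0 : ℝ)..t, h s with hΦ
  have hΦc : Continuous Φ := intervalIntegral.continuous_primitive hh 0
  have hac : AbsolutelyContinuousOnInterval Φ 0 x :=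
    (hh 0 x).absolutelyContinuousOnInterval_primitive left_mem_uIcc
  have hpow : ∀ m : ℕ, AbsolutelyContinuousOnInterval (fun t => Φ t ^ m) 0 x := by
    intro m
    induction m with
    | zero => simpa using AbsolutelyContinuousOnInterval.const (1 : ℝ) 0 x
    | succ m ih =>
      simp only [pow_succ]
      exact ih.mul hac
  have hd : ∀ᵐ t, t ∈ uIoc 0 x → HasDerivAt (fun t => ((k + 1).factorial : ℝ)⁻¹ * Φ t ^ (k + 1))
      (h t * (Φ t ^ k / k.factorial)) t := by
    filter_upwards [(hh 0 x).ae_hasDerivAt_integral] with t ht htx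
    have h1 := ((ht (uIoc_subset_uIcc htx) 0 left_mem_uIcc).pow (k + 1)).const_mul
      ((k + 1).factorial : ℝ)⁻¹
    refine h1.congr_deriv ?_
    rw [Nat.factorial_succ]
    have : (k.factorial : ℝ) ≠ 0 := by positivity
    push_cast
    field_simp
    exact mul_comm _ _
  rw [((hpow (k + 1)).const_mul ((k + 1).factorial : ℝ)⁻¹).integral_eq_sub_of_ae_hasDerivAt hd
    ((hh 0 x).mul_continuousOn ((hΦc.pow k).div_const _).continuousOn)]
  simp [hΦ, div_eq_inv_mul]

/-- The factor `‖1‖` is kept because the algebra may be zero: this is the case `n = 0`. -/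
theorem norm_propagatorCoeff_le (hA : ∀ a b, IntervalIntegrable A volume a b) (k : ℕ) {x : ℝ}
    (hx : 0 ≤ x) :
    ‖propagatorCoeff A k x‖ ≤ ‖(1 : 𝔸)‖ * ((∫ t in (0 : ℝ)..x, ‖A t‖) ^ k / k.factorial) := by
  induction k generalizing x with
  | zero => simp [propagatorCoeff]
  | succ k ih =>
    have hn : ∀ a b, IntervalIntegrable (fun t => ‖A t‖) volume a b := fun a b => (hA a b).norm
    rw [← integral_mul_primitive_pow hn, ← intervalIntegral.integral_const_mul]
    refine intervalIntegral.norm_integral_le_of_norm_le hx (ae_of_all _ fun t ht => ?_)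
      (IntervalIntegrable.const_mul ((hn 0 x).mul_continuousOn
        (((intervalIntegral.continuous_primitive hn 0).pow k).div_const _).continuousOn) _)
    calc ‖A t * propagatorCoeff A k t‖ ≤ ‖A t‖ * ‖propagatorCoeff A k t‖ := norm_mul_le _ _
      _ ≤ ‖A t‖ * _ := mul_le_mul_of_nonneg_left (ih ht.1.le) (norm_nonneg _)
      _ = _ := by ring

omit [NormedAlgebra ℂ 𝔸] in
theorem summable_propagatorBound (r b : ℝ) : Summable (propagatorBound A r b) :=
  (Real.summable_pow_div_factorial _).mul_left _

theorem norm_smul_propagatorCoeff_le (hA : ∀ a b, IntervalIntegrable A volume a b) {r b x : ℝ}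
    {z : ℂ} (hz : ‖z‖ ≤ r) (hx : 0 ≤ x) (hxb : x ≤ b) (k : ℕ) :
    ‖z ^ k • propagatorCoeff A k x‖ ≤ propagatorBound A r b k := by
  have hr : 0 ≤ r := (norm_nonneg z).trans hz
  have h1 : (∫ t in (0 : ℝ)..x, ‖A t‖) ≤ ∫ t in (0 : ℝ)..b, ‖A t‖ :=
    intervalIntegral.integral_mono_interval le_rfl hx hxb (ae_of_all _ fun t => norm_nonneg _)
      (hA 0 b).norm
  have h0 : 0 ≤ ∫ t in (0 : ℝ)..x, ‖A t‖ :=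
    intervalIntegral.integral_nonneg hx fun t _ => norm_nonneg _
  rw [norm_smul, norm_pow]
  calc ‖z‖ ^ k * ‖propagatorCoeff A k x‖
      ≤ r ^ k * (‖(1 : 𝔸)‖ * ((∫ t in (0 : ℝ)..b, ‖A t‖) ^ k / k.factorial)) := by
        refine mul_le_mul (by gcongr) ((norm_propagatorCoeff_le hA k hx).trans ?_)
          (norm_nonneg _) (by positivity)
        gcongr
    _ = _ := by rw [propagatorBound, mul_pow]; ring

theorem norm_propagator_le (hA : ∀ a b, IntervalIntegrable A volume a b) {r b x : ℝ}
    {z : ℂ} (hz : ‖z‖ ≤ r) (hx : 0 ≤ x) (hxb : x ≤ b) :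
    ‖propagator A z x‖ ≤ ∑' k, propagatorBound A r b k :=
  tsum_of_norm_bounded (summable_propagatorBound r b).hasSum
    (norm_smul_propagatorCoeff_le hA hz hx hxb)

variable [CompleteSpace 𝔸]

theorem hasSum_propagator (hA : ∀ a b, IntervalIntegrable A volume a b) (z : ℂ) {x : ℝ}
    (hx : 0 ≤ x) : HasSum (fun k => z ^ k • propagatorCoeff A k x) (propagator A z x) :=
  (Summable.of_norm_bounded (summable_propagatorBound ‖z‖ x)
    (norm_smul_propagatorCoeff_le hA le_rfl hx le_rfl)).hasSum

theorem continuousOn_propagator (hA : ∀ a b, IntervalIntegrable A volume a b) (z : ℂ) (b : ℝ) :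
    ContinuousOn (propagator A z) (Icc 0 b) :=
  continuousOn_tsum (fun k => ((continuous_propagatorCoeff hA k).const_smul _).continuousOn)
    (summable_propagatorBound ‖z‖ b)
    fun k _ hx => norm_smul_propagatorCoeff_le hA le_rfl hx.1 hx.2 k

theorem differentiable_propagator (hA : ∀ a b, IntervalIntegrable A volume a b) {x : ℝ}
    (hx : 0 ≤ x) : Differentiable ℂ fun z => propagator A z x := fun z =>
  (Complex.differentiableOn_tsum_of_summable_norm (summable_propagatorBound (‖z‖ + 1) x)
    (fun k => ((differentiable_id.pow k).smul_const (propagatorCoeff A k x)).differentiableOn)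
    Metric.isOpen_ball fun k w hw => norm_smul_propagatorCoeff_le hA
      (mem_ball_zero_iff.1 hw).le hx le_rfl k).differentiableAt
    (Metric.isOpen_ball.mem_nhds (by simp : z ∈ Metric.ball (0 : ℂ) (‖z‖ + 1)))

/-- Termwise integration by dominated convergence, with `‖A t‖` times the exponential series as
majorant. -/
theorem hasSum_integral_propagator (hA : ∀ a b, IntervalIntegrable A volume a b) (z : ℂ) {x : ℝ}
    (hx : 0 ≤ x) : HasSum (fun k => ∫ t in (0 : ℝ)..x, A t * (z ^ k • propagatorCoeff A k t))
      (∫ t in (0 : ℝ)..x, A t * propagator A z t) := by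
  have hm : ∀ k, IntervalIntegrable (fun t => A t * (z ^ k • propagatorCoeff A k t)) volume 0 x :=
    fun k => (hA 0 x).mul_continuousOn
      ((continuous_propagatorCoeff hA k).const_smul (z ^ k)).continuousOn
  have hbi : IntervalIntegrable (fun t => ∑' k, ‖A t‖ * propagatorBound A ‖z‖ x k) volume 0 x := by
    simp only [tsum_mul_left]
    exact (hA 0 x).norm.mul_const _
  refine intervalIntegral.hasSum_integral_of_dominated_convergence
    (fun k t => ‖A t‖ * propagatorBound A ‖z‖ x k) (fun k => (hm k).def'.aestronglyMeasurable)
    (fun k => ae_of_all _ fun t ht => (norm_mul_le _ _).trans ?_)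
    (ae_of_all _ fun t _ => (summable_propagatorBound _ _).mul_left _) hbi
    (ae_of_all _ fun t ht => ?_)
  · rw [uIoc_of_le hx] at ht
    exact mul_le_mul_of_nonneg_left (norm_smul_propagatorCoeff_le hA le_rfl ht.1.le ht.2 k)
      (norm_nonneg _)
  · rw [uIoc_of_le hx] at ht
    exact (hasSum_propagator hA z ht.1.le).mul_left _

/-- The integral equation of the propagator. -/
theorem propagator_eq (hA : ∀ a b, IntervalIntegrable A volume a b) (z : ℂ) {x : ℝ}
    (hx : 0 ≤ x) :
    propagator A z x = 1 + z • ∫ t in (0 : ℝ)..x, A t * propagator A z t := by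
  have h2 := (hasSum_integral_propagator hA z hx).const_smul z
  have h3 : ∀ k, z • ∫ t in (0 : ℝ)..x, A t * (z ^ k • propagatorCoeff A k t) =
      z ^ (k + 1) • propagatorCoeff A (k + 1) x := fun k => by
    rw [propagatorCoeff, pow_succ', mul_smul, ← intervalIntegral.integral_smul (z ^ k)]
    simp only [mul_smul_comm]
  simp only [h3] at h2
  -- Integrating the series shifts it by one index; only the constant term `1` is missing.
  have h5 := (hasSum_nat_add_iff' 1).2 (hasSum_propagator hA z hx)
  rw [h2.unique h5, Finset.sum_range_one, pow_zero, one_smul]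
  exact (add_sub_cancel _ _).symm

end Propagator

/-! ### The semi-inner product of `L²_H` and truncation -/

namespace HalfLineSystem

variable {n : ℕ} (S : HalfLineSystem n)

/-- The vectors `ℂ²ⁿ`. -/
abbrev Phase (n : ℕ) : Type := Fin n ⊕ Fin n → ℂ

/-- The integrand `f(x)* H(x) g(x)` of the scalar product. -/
noncomputable def density (x : ℝ) (v w : Phase n) : ℂ := star v ⬝ᵥ (S.H x *ᵥ w)

section Density

variable (x : ℝ) (u v w : Phase n) (c : ℂ)

theorem density_add_left : S.density x (u + v) w = S.density x u w + S.density x v w := by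
  simp only [density, star_add, add_dotProduct]

theorem density_add_right : S.density x u (v + w) = S.density x u v + S.density x u w := by
  simp only [density, mulVec_add, dotProduct_add]

theorem density_smul_left : S.density x (c • v) w = star c * S.density x v w := by
  simp only [density, star_smul, smul_dotProduct, smul_eq_mul]

theorem density_smul_right : S.density x v (c • w) = c * S.density x v w := by
  simp only [density, mulVec_smul, dotProduct_smul, smul_eq_mul]

@[simp] theorem density_zero_left : S.density x 0 w = 0 := by simp [density]

@[simp] theorem density_zero_right : S.density x v 0 = 0 := by simp [density]

/-- Reduces integrability of the mixed densities to that of the quadratic ones, which is what finite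
energy provides. The signs of the `I` terms reflect antilinearity in the first variable. -/
theorem density_polarization : S.density x v w =
    (1 / 4) * (S.density x (v + w) (v + w)
      - S.density x (v + (-1 : ℂ) • w) (v + (-1 : ℂ) • w)
      - Complex.I * S.density x (v + Complex.I • w) (v + Complex.I • w)
      + Complex.I * S.density x (v + (-Complex.I) • w) (v + (-Complex.I) • w)) := by
  simp only [density_add_left, density_add_right, density_smul_left, density_smul_right,
    Complex.star_def, map_neg, map_one, Complex.conj_I]
  ring_nf
  simp only [Complex.I_sq, mul_assoc]
  ring

end Density

theorem star_density {x : ℝ} (hx : (S.H x).PosSemidef) (v w : Phase n) :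
    star (S.density x v w) = S.density x w v := by
  rw [density, density, star_dotProduct, star_mulVec, hx.1.eq, ← dotProduct_mulVec, star_star]

theorem density_self_eq {x : ℝ} (hx : (S.H x).PosSemidef) (v : Phase n) :
    S.density x v v = ((S.density x v v).re : ℂ) := by
  have h := (Complex.le_def.1 (hx.dotProduct_mulVec_nonneg v)).2
  exact Complex.ext rfl h.symm

theorem density_self_re_nonneg {x : ℝ} (hx : (S.H x).PosSemidef) (v : Phase n) :
    0 ≤ (S.density x v v).re :=
  (Complex.le_def.1 (hx.dotProduct_mulVec_nonneg v)).1

theorem aemeasurable_density {f g : ℝ → Phase n}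
    (hf : AEMeasurable f (volume.restrict (Ioi 0)))
    (hg : AEMeasurable g (volume.restrict (Ioi 0))) :
    AEMeasurable (fun x => S.density x (f x) (g x)) (volume.restrict (Ioi 0)) := by
  have hH : ∀ i j, AEMeasurable (fun x => S.H x i j) (volume.restrict (Ioi (0 : ℝ))) :=
    fun i j => (S.locallyIntegrable i j).aestronglyMeasurable.aemeasurable
  simp only [density, dotProduct, mulVec, Pi.star_apply]
  refine Finset.aemeasurable_fun_sum _ fun i _ => ?_
  refine ((continuous_star.measurable).comp_aemeasurable (aemeasurable_pi_iff.1 hf i)).mul ?_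
  exact Finset.aemeasurable_fun_sum _ fun j _ => (hH i j).mul (aemeasurable_pi_iff.1 hg j)

theorem integrable_density_self {f : ℝ → Phase n} (hf : f ∈ S.preL2) :
    IntegrableOn (fun x => S.density x (f x) (f x)) (Ioi 0) := by
  refine ⟨(S.aemeasurable_density hf.1 hf.1).aestronglyMeasurable, ?_⟩
  refine lt_of_le_of_lt (lintegral_mono_ae ?_) hf.2
  filter_upwards [S.posSemidef] with x hx
  rw [S.density_self_eq hx, ← ofReal_norm, Complex.norm_real, Real.norm_eq_abs,
    abs_of_nonneg (S.density_self_re_nonneg hx _)]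
  rfl

theorem integrable_density {f g : ℝ → Phase n} (hf : f ∈ S.preL2) (hg : g ∈ S.preL2) :
    IntegrableOn (fun x => S.density x (f x) (g x)) (Ioi 0) := by
  have h : ∀ c : ℂ, IntegrableOn
      (fun x => S.density x (f x + c • g x) (f x + c • g x)) (Ioi 0) := fun c =>
    S.integrable_density_self (S.preL2.add_mem hf (S.preL2.smul_mem c hg))
  have h1 := h 1
  simp only [one_smul] at h1
  simp only [S.density_polarization _ (f _)]
  exact (((h1.sub (h (-1))).sub ((h Complex.I).const_mul _)).add
    ((h (-Complex.I)).const_mul _)).const_mul _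

/-- The scalar product of `L²_H(0, ∞)`, antilinear in the first variable. -/
noncomputable def ip (f g : S.preL2) : ℂ :=
  ∫ x in Ioi (0 : ℝ), S.density x ((f : ℝ → Phase n) x) ((g : ℝ → Phase n) x)

theorem star_ip (f g : S.preL2) : star (S.ip f g) = S.ip g f := by
  unfold ip
  rw [Complex.star_def, ← integral_conj]
  exact integral_congr_ae (S.posSemidef.mono fun x hx => S.star_density hx _ _)

theorem ip_add_left (f g h : S.preL2) : S.ip (f + g) h = S.ip f h + S.ip g h := by
  unfold ip
  rw [← integral_add (S.integrable_density f.2 h.2) (S.integrable_density g.2 h.2)]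
  exact integral_congr_ae (ae_of_all _ fun x => S.density_add_left _ _ _ _)

theorem ip_smul_left (c : ℂ) (f g : S.preL2) : S.ip (c • f) g = star c * S.ip f g := by
  unfold ip
  rw [← integral_const_mul]
  exact integral_congr_ae (ae_of_all _ fun x => S.density_smul_left _ _ _ _)

theorem ip_add_right (f g h : S.preL2) : S.ip f (g + h) = S.ip f g + S.ip f h := by
  rw [← S.star_ip, ip_add_left, star_add, star_ip, star_ip]

theorem ip_smul_right (c : ℂ) (f g : S.preL2) : S.ip f (c • g) = c * S.ip f g := by
  rw [← S.star_ip, ip_smul_left, star_mul', star_ip, star_star]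

theorem ip_neg_left (f g : S.preL2) : S.ip (-f) g = -S.ip f g := by
  rw [← neg_one_smul ℂ f, ip_smul_left]; simp

theorem ip_neg_right (f g : S.preL2) : S.ip f (-g) = -S.ip f g := by
  rw [← neg_one_smul ℂ g, ip_smul_right]; simp

theorem ip_sub_left (f g h : S.preL2) : S.ip (f - g) h = S.ip f h - S.ip g h := by
  rw [sub_eq_add_neg, ip_add_left, ip_neg_left, sub_eq_add_neg]

theorem ip_sub_right (f g h : S.preL2) : S.ip f (g - h) = S.ip f g - S.ip f h := by
  rw [sub_eq_add_neg, ip_add_right, ip_neg_right, sub_eq_add_neg]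

/-- The squared seminorm of `L²_H(0, ∞)`. -/
noncomputable def nsq (f : S.preL2) : ℝ := (S.ip f f).re

theorem nsq_eq_integral (f : S.preL2) :
    S.nsq f = ∫ x in Ioi (0 : ℝ), (S.density x (f.1 x) (f.1 x)).re :=
  (integral_re (S.integrable_density_self f.2)).symm

theorem nsq_nonneg (f : S.preL2) : 0 ≤ S.nsq f := by
  rw [nsq_eq_integral]
  exact integral_nonneg_of_ae (S.posSemidef.mono fun x hx => S.density_self_re_nonneg hx _)

theorem ip_self (f : S.preL2) : S.ip f f = (S.nsq f : ℂ) := by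
  have h := S.star_ip f f
  exact Complex.ext rfl (by
    have := congrArg Complex.im h
    simp only [Complex.star_def, Complex.conj_im, Complex.ofReal_im] at this ⊢
    linarith)

theorem energy_eq_ofReal_nsq (f : S.preL2) : S.energy f = ENNReal.ofReal (S.nsq f) := by
  have h : IntegrableOn (fun x => (S.density x (f.1 x) (f.1 x)).re) (Ioi 0) :=
    (S.integrable_density_self f.2).re
  rw [nsq_eq_integral, ofReal_integral_eq_lintegral_ofReal h
    (S.posSemidef.mono fun x hx => S.density_self_re_nonneg hx _)]
  rfl

theorem ae_mulVec_eq_zero_of_energy_eq_zero {f : ℝ → Phase n}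
    (hf : AEMeasurable f (volume.restrict (Ioi 0))) (h : S.energy f = 0) :
    ∀ᵐ x ∂volume.restrict (Ioi (0 : ℝ)), S.H x *ᵥ f x = 0 := by
  have h1 := (lintegral_eq_zero_iff' (S.aemeasurable_energyDensity hf)).1 h
  filter_upwards [h1, S.posSemidef] with x hx hp
  have h2 : (S.density x (f x) (f x)).re ≤ 0 := ENNReal.ofReal_eq_zero.1 hx
  refine (hp.dotProduct_mulVec_zero_iff _).1 ?_
  change S.density x (f x) (f x) = 0
  rw [S.density_self_eq hp, le_antisymm h2 (S.density_self_re_nonneg hp _), Complex.ofReal_zero]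

/-- The scalar product of `L²_H(0, ∞)` as a structure. -/
@[reducible] noncomputable def ipCore : PreInnerProductSpace.Core ℂ S.preL2 where
  inner := S.ip
  conj_inner_symm f g := S.star_ip g f
  re_inner_nonneg := S.nsq_nonneg
  add_left := S.ip_add_left
  smul_left f g c := S.ip_smul_left c f g

/-- The Cauchy-Schwarz inequality. -/
theorem norm_ip_le (f g : S.preL2) : ‖S.ip f g‖ ≤ √(S.nsq f) * √(S.nsq g) := by
  have h : ‖S.ip f g‖ * ‖S.ip g f‖ ≤ S.nsq f * S.nsq g :=
    @InnerProductSpace.Core.inner_mul_inner_self_le ℂ S.preL2 _ _ _ S.ipCore f g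
  rw [← S.star_ip f g, norm_star] at h
  rw [← Real.sqrt_mul (S.nsq_nonneg f), ← sq] at *
  exact Real.le_sqrt_of_sq_le h

/-! ### Truncation -/

theorem indicator_mem_preL2 {f : ℝ → Phase n} (hf : f ∈ S.preL2) {s : Set ℝ}
    (hs : MeasurableSet s) : s.indicator f ∈ S.preL2 := by
  refine ⟨hf.1.indicator hs, lt_of_le_of_lt (lintegral_mono fun x => ?_) hf.2⟩
  by_cases hx : x ∈ s <;> simp [energyDensity, hx]

/-- The functions whose restrictions to bounded intervals `(0, b)` are in `L²_H`. -/
def locL2 : Submodule ℂ (ℝ → Phase n) where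
  carrier := {f | ∀ b : ℝ, (Ioc 0 b).indicator f ∈ S.preL2}
  zero_mem' b := by simp
  add_mem' hf hg b := by
    rw [indicator_add']
    exact S.preL2.add_mem (hf b) (hg b)
  smul_mem' c f hf b := by
    rw [show (Ioc 0 b).indicator (c • f) = c • (Ioc 0 b).indicator f from
      indicator_const_smul _ c f]
    exact S.preL2.smul_mem c (hf b)

theorem preL2_le_locL2 : S.preL2 ≤ S.locL2 := fun _ hf _ =>
  S.indicator_mem_preL2 hf measurableSet_Ioc

/-- Truncation to `(0, b]`. -/
noncomputable def trunc (b : ℝ) : S.locL2 →ₗ[ℂ] S.preL2 where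
  toFun f := ⟨(Ioc 0 b).indicator f, f.2 b⟩
  map_add' _ _ := Subtype.ext (indicator_add' _ _ _)
  map_smul' c f := Subtype.ext (indicator_const_smul _ c (f : ℝ → Phase n))

theorem density_indicator (s : Set ℝ) (f g : ℝ → Phase n) (x : ℝ) :
    S.density x (s.indicator f x) (s.indicator g x) =
      s.indicator (fun x => S.density x (f x) (g x)) x := by
  by_cases hx : x ∈ s <;> simp [hx]

theorem ip_trunc (b : ℝ) (f g : S.locL2) : S.ip (S.trunc b f) (S.trunc b g) =
    ∫ x in Ioc 0 b, S.density x ((f : ℝ → Phase n) x) ((g : ℝ → Phase n) x) := by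
  have h : ∀ x, S.density x ((S.trunc b f : ℝ → Phase n) x) ((S.trunc b g : ℝ → Phase n) x) =
    (Ioc 0 b).indicator (fun x => S.density x ((f : ℝ → Phase n) x) ((g : ℝ → Phase n) x)) x :=
    fun x => S.density_indicator _ f g x
  simp only [ip, h]
  rw [setIntegral_indicator measurableSet_Ioc,
    inter_eq_self_of_subset_right Ioc_subset_Ioi_self]

theorem integrableOn_density_locL2 (b : ℝ) (f g : S.locL2) :
    IntegrableOn (fun x => S.density x ((f : ℝ → Phase n) x) ((g : ℝ → Phase n) x))
      (Ioc 0 b) := by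
  have h := (S.integrable_density (f.2 b) (g.2 b)).mono_set
    (Ioc_subset_Ioi_self : Ioc 0 b ⊆ Ioi 0)
  refine h.congr_fun (fun x hx => ?_) measurableSet_Ioc
  simp only [indicator_of_mem hx]

/-- Truncation is a self-adjoint projection. -/
theorem ip_trunc_left (b : ℝ) (f : S.locL2) (g : S.preL2) :
    S.ip (S.trunc b f) g = S.ip (S.trunc b f) (S.trunc b ⟨g, S.preL2_le_locL2 g.2⟩) := by
  unfold ip
  refine integral_congr_ae (ae_of_all _ fun x => ?_)
  by_cases hx : x ∈ Ioc 0 b <;> simp [trunc, hx]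

theorem nsq_trunc_eq_integral (b : ℝ) (f : S.locL2) : S.nsq (S.trunc b f) =
    ∫ x in Ioc 0 b, (S.density x ((f : ℝ → Phase n) x) ((f : ℝ → Phase n) x)).re := by
  rw [nsq, ip_trunc]
  exact (integral_re (S.integrableOn_density_locL2 b f f)).symm

theorem nsq_trunc_mono (f : S.locL2) {a b : ℝ} (hab : a ≤ b) :
    S.nsq (S.trunc a f) ≤ S.nsq (S.trunc b f) := by
  rw [nsq_trunc_eq_integral, nsq_trunc_eq_integral]
  refine setIntegral_mono_set (S.integrableOn_density_locL2 b f f).re ?_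
    (LE.le.eventuallyLE (Ioc_subset_Ioc_right hab))
  exact (ae_restrict_of_ae_restrict_of_subset Ioc_subset_Ioi_self
    S.posSemidef).mono fun x hx => S.density_self_re_nonneg hx _

theorem nsq_trunc_le (f : S.preL2) (b : ℝ) :
    S.nsq (S.trunc b ⟨f, S.preL2_le_locL2 f.2⟩) ≤ S.nsq f := by
  rw [nsq_trunc_eq_integral, nsq_eq_integral]
  exact setIntegral_mono_set (S.integrable_density_self f.2).re
    (S.posSemidef.mono fun x hx => S.density_self_re_nonneg hx _)
    (LE.le.eventuallyLE Ioc_subset_Ioi_self)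

theorem aemeasurable_of_mem_locL2 {f : ℝ → Phase n} (hf : f ∈ S.locL2) :
    AEMeasurable f (volume.restrict (Ioi 0)) := by
  refine aemeasurable_of_tendsto_metrizable_ae Filter.atTop
    (f := fun k : ℕ => (Ioc (0 : ℝ) k).indicator f) (fun k => (hf k).1) ?_
  filter_upwards [ae_restrict_mem measurableSet_Ioi] with x hx
  obtain ⟨N, hN⟩ := exists_nat_ge x
  refine tendsto_const_nhds.congr' ?_
  filter_upwards [Filter.eventually_ge_atTop N] with k hk
  rw [indicator_of_mem]
  exact ⟨hx, hN.trans (by exact_mod_cast hk)⟩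

/-- A function is in `L²_H(0, ∞)` if the norms of its truncations are bounded. -/
theorem mem_preL2_of_nsq_trunc_le (f : S.locL2) {C : ℝ}
    (h : ∀ k : ℕ, S.nsq (S.trunc k f) ≤ C) : (f : ℝ → Phase n) ∈ S.preL2 := by
  refine ⟨S.aemeasurable_of_mem_locL2 f.2, ?_⟩
  -- The energy over `(0, ∞)` is the supremum of the energies over `(0, k]`, by monotone
  -- convergence.
  have hU : Ioi (0 : ℝ) = ⋃ k : ℕ, Ioc 0 (k : ℝ) := by
    ext x
    simp only [mem_Ioi, mem_iUnion, mem_Ioc]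
    exact ⟨fun hx => (exists_nat_ge x).imp fun k hk => ⟨hx, hk⟩, fun ⟨_, hx, _⟩ => hx⟩
  have hd : Directed (· ⊆ ·) fun k : ℕ => Ioc (0 : ℝ) k :=
    directed_of_isDirected_le fun i j hij => Ioc_subset_Ioc_right (by exact_mod_cast hij)
  refine lt_of_le_of_lt ?_ (ENNReal.ofReal_lt_top (r := C))
  unfold energy
  rw [hU, setLIntegral_iUnion_of_directed _ hd]
  refine iSup_le fun k => ?_
  refine le_trans (le_of_eq ?_) (ENNReal.ofReal_le_ofReal (h k))
  have hi : IntegrableOn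
      (fun x => (S.density x ((f : ℝ → Phase n) x) ((f : ℝ → Phase n) x)).re) (Ioc 0 k) :=
    (S.integrableOn_density_locL2 k f f).re
  rw [nsq_trunc_eq_integral, ofReal_integral_eq_lintegral_ofReal hi
    ((ae_restrict_of_ae_restrict_of_subset Ioc_subset_Ioi_self
    S.posSemidef).mono fun x hx => S.density_self_re_nonneg hx _)]
  rfl

open Filter Topology in
theorem tendsto_nsq_sub_trunc (f : S.preL2) :
    Tendsto (fun k : ℕ => S.nsq (f - S.trunc k ⟨f, S.preL2_le_locL2 f.2⟩)) atTop (𝓝 0) := by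
  simp only [nsq_eq_integral]
  suffices h : Tendsto (fun k : ℕ => ∫ x in Ioi (0 : ℝ),
      (S.density x ((f - S.trunc k ⟨f, S.preL2_le_locL2 f.2⟩ : S.preL2).1 x)
        ((f - S.trunc k ⟨f, S.preL2_le_locL2 f.2⟩ : S.preL2).1 x)).re) atTop
      (𝓝 (∫ _ in Ioi (0 : ℝ), (0 : ℝ))) by
    rwa [integral_zero] at h
  refine tendsto_integral_of_dominated_convergence (G := ℝ)
    (fun x => (S.density x (f.1 x) (f.1 x)).re) (fun k => ?_)
    (S.integrable_density_self f.2).re (fun k => ?_) ?_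
  · exact (S.integrable_density_self
      (f - S.trunc k ⟨f, S.preL2_le_locL2 f.2⟩).2).re.aestronglyMeasurable
  · filter_upwards [S.posSemidef] with x hx
    by_cases hxk : x ∈ Ioc (0 : ℝ) k
    · simpa [trunc, hxk] using S.density_self_re_nonneg hx _
    · simp [trunc, hxk, abs_of_nonneg (S.density_self_re_nonneg hx _)]
  · filter_upwards [ae_restrict_mem measurableSet_Ioi] with x hx
    obtain ⟨N, hN⟩ := exists_nat_ge x
    refine tendsto_const_nhds.congr' ?_
    filter_upwards [eventually_ge_atTop N] with k hk
    have hxk : x ∈ Ioc (0 : ℝ) k := ⟨hx, hN.trans (by exact_mod_cast hk)⟩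
    simp [trunc, hxk]

end HalfLineSystem

/-! ### Solutions of the canonical system and the Lagrange identity -/

namespace HalfLineSystem

variable {n : ℕ} (S : HalfLineSystem n)

variable {S} in
-- Regularity covers a neighbourhood of `0`, local integrability the remaining compact interval `[c
-- / 2, b]`.
theorem RegularAtZero.integrableOn (hreg : S.RegularAtZero) (b : ℝ) (i j : Fin n ⊕ Fin n) :
    IntegrableOn (fun x => S.H x i j) (Ioc 0 b) := by
  obtain ⟨c, hc, h⟩ := hreg
  have h2 : IntegrableOn (fun x => S.H x i j) (Icc (c / 2) b) :=
    (S.locallyIntegrable i j).integrableOn_compact_subset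
      (fun x hx => (half_pos hc).trans_le hx.1) isCompact_Icc
  refine ((h i j).union h2).mono_set fun x hx => ?_
  rcases lt_or_ge x c with hxc | hxc
  · exact Or.inl ⟨hx.1, hxc⟩
  · exact Or.inr ⟨by linarith, hx.2⟩

variable {S} in
theorem RegularAtZero.mem_locL2 (hreg : S.RegularAtZero) {f : ℝ → Phase n}
    (hf : ContinuousOn f (Ici 0)) : f ∈ S.locL2 := by
  intro b
  have hm : AEMeasurable f (volume.restrict (Ioi 0)) :=
    (hf.mono Ioi_subset_Ici_self).aemeasurable measurableSet_Ioi
  refine ⟨hm.indicator measurableSet_Ioc, ?_⟩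
  rcases lt_or_ge b 0 with hb | hb
  · rw [Ioc_eq_empty (by linarith), indicator_empty]
    exact S.preL2.zero_mem.2
  have hfc : ∀ i, ContinuousOn (fun x => f x i) (uIcc 0 b) := fun i =>
    (continuousOn_pi.1 hf i).mono (by rw [uIcc_of_le hb]; exact Icc_subset_Ici_self)
  have hi : IntervalIntegrable (fun x => S.density x (f x) (f x)) volume 0 b := by
    simp only [density, dotProduct, mulVec, Finset.mul_sum]
    rw [intervalIntegrable_iff]
    refine integrable_finsetSum _ fun i _ => integrable_finsetSum _ fun j _ => ?_
    have hH : IntervalIntegrable (fun x => S.H x i j) volume 0 b :=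
      (intervalIntegrable_iff_integrableOn_Ioc_of_le hb).2 (hreg.integrableOn b i j)
    exact ((hH.mul_continuousOn (hfc j)).continuousOn_mul (hfc i).star).def'
  have hi2 := ((intervalIntegrable_iff_integrableOn_Ioc_of_le hb).1 hi).2
  refine lt_of_le_of_lt ?_ hi2
  have he : ∀ x, S.energyDensity ((Ioc 0 b).indicator f) x =
      (Ioc 0 b).indicator (S.energyDensity f) x := fun x => by
    by_cases hx : x ∈ Ioc 0 b <;> simp [energyDensity, hx]
  simp only [energy, he]
  rw [setLIntegral_indicator measurableSet_Ioc,
    inter_eq_self_of_subset_left Ioc_subset_Ioi_self]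
  refine lintegral_mono fun x => ?_
  rw [← ofReal_norm]
  exact ENNReal.ofReal_le_ofReal (Complex.re_le_norm _)

/-- The coefficient `A` of the system written as `y' = z A y`, as a function with values in the
bounded operators that vanishes on `(-∞, 0]`. -/
noncomputable def coeff : ℝ → Phase n →L[ℂ] Phase n :=
  (Ioi 0).indicator fun x =>
    LinearMap.toContinuousLinearMap (Matrix.toLin' (Matrix.J (Fin n) ℂ * S.H x))

theorem coeff_apply {x : ℝ} (hx : 0 < x) (w : Phase n) :
    S.coeff x w = Matrix.J (Fin n) ℂ *ᵥ (S.H x *ᵥ w) := by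
  rw [coeff, indicator_of_mem (mem_Ioi.2 hx), LinearMap.coe_toContinuousLinearMap', toLin'_apply,
    mulVec_mulVec]

theorem J_mulVec_J_mulVec (w : Phase n) :
    Matrix.J (Fin n) ℂ *ᵥ (Matrix.J (Fin n) ℂ *ᵥ w) = -w := by
  rw [mulVec_mulVec, J_squared, neg_mulVec, one_mulVec]

theorem _root_.MeasureTheory.Integrable.linearMap_matrix {X ι E : Type*} [MeasurableSpace X]
    {μ : Measure X} [Fintype ι] [DecidableEq ι] [NormedAddCommGroup E] [NormedSpace ℂ E]
    (L : Matrix ι ι ℂ →ₗ[ℂ] E) {A : X → Matrix ι ι ℂ}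
    (hA : ∀ i j, Integrable (fun x => A x i j) μ) : Integrable (fun x => L (A x)) μ := by
  have h : ∀ x, L (A x) = ∑ i, ∑ j, A x i j • L (Matrix.single i j 1) := fun x => by
    conv_lhs => rw [matrix_eq_sum_single (A x)]
    simp only [map_sum, ← map_smul, smul_single, smul_eq_mul, mul_one]
  simp only [h]
  exact integrable_finsetSum _ fun i _ => integrable_finsetSum _ fun j _ => (hA i j).smul_const _

theorem intervalIntegrable_coeff (hreg : S.RegularAtZero) (a b : ℝ) :
    IntervalIntegrable S.coeff volume a b := by
  rw [intervalIntegrable_iff]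
  refine IntegrableOn.integrable_indicator (f := fun x => LinearMap.toContinuousLinearMap
    (Matrix.toLin' (Matrix.J (Fin n) ℂ * S.H x))) ?_ measurableSet_Ioi
  have hs : Ioi 0 ∩ uIoc a b ⊆ Ioc 0 (max a b) := fun x hx => ⟨hx.1, hx.2.2⟩
  rw [IntegrableOn, Measure.restrict_restrict measurableSet_Ioi]
  exact Integrable.linearMap_matrix
    (LinearMap.toContinuousLinearMap.toLinearMap ∘ₗ Matrix.toLin'.toLinearMap ∘ₗ
      LinearMap.mulLeft ℂ (Matrix.J (Fin n) ℂ)) fun i j =>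
    (hreg.integrableOn (max a b) i j).mono_set hs

/-- The solution of `J y' = -z H y` with `y(0) = w`, as a function. -/
noncomputable def solFun (z : ℂ) (w : Phase n) (x : ℝ) : Phase n := propagator S.coeff z x w

theorem continuousOn_solFun (hreg : S.RegularAtZero) (z : ℂ) (w : Phase n) :
    ContinuousOn (S.solFun z w) (Ici 0) := by
  have h : ContinuousOn (propagator S.coeff z) (Ici 0) := by
    intro x hx
    refine ((continuousOn_propagator (S.intervalIntegrable_coeff hreg) z (x + 1)) x
      ⟨hx, by linarith⟩).mono_of_mem_nhdsWithin ?_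
    refine mem_nhdsWithin.2 ⟨Iio (x + 1), isOpen_Iio, by simp, fun y hy => ⟨hy.2, hy.1.le⟩⟩
  exact h.clm_apply continuousOn_const

theorem intervalIntegrable_coeff_solFun (hreg : S.RegularAtZero) (z : ℂ) (w : Phase n) {b : ℝ}
    (hb : 0 ≤ b) :
    IntervalIntegrable (fun t => S.coeff t (S.solFun z w t)) volume 0 b := by
  have h : IntervalIntegrable (fun t => S.coeff t * propagator S.coeff z t) volume 0 b := by
    refine (S.intervalIntegrable_coeff hreg 0 b).mul_continuousOn ?_
    rw [uIcc_of_le hb]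
    exact continuousOn_propagator (S.intervalIntegrable_coeff hreg) z b
  rw [intervalIntegrable_iff] at h ⊢
  exact (ContinuousLinearMap.apply ℂ (Phase n) w).integrable_comp h

theorem solFun_eq (hreg : S.RegularAtZero) (z : ℂ) (w : Phase n) {x : ℝ} (hx : 0 ≤ x) :
    S.solFun z w x = w + z • ∫ t in (0 : ℝ)..x, S.coeff t (S.solFun z w t) := by
  have h : IntervalIntegrable (fun t => S.coeff t * propagator S.coeff z t) volume 0 x := by
    refine (S.intervalIntegrable_coeff hreg 0 x).mul_continuousOn ?_
    rw [uIcc_of_le hx]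
    exact continuousOn_propagator (S.intervalIntegrable_coeff hreg) z x
  unfold solFun
  rw [propagator_eq (S.intervalIntegrable_coeff hreg) z hx, _root_.add_apply,
    _root_.smul_apply, ContinuousLinearMap.intervalIntegral_apply h]
  rfl

theorem solFun_zero (hreg : S.RegularAtZero) (z : ℂ) (w : Phase n) : S.solFun z w 0 = w := by
  simp [S.solFun_eq hreg z w le_rfl]

/-- `f` is absolutely continuous on every interval `[0, b]` and `J f' = -H g` almost
everywhere. -/
structure Solves (f g : ℝ → Phase n) : Prop where
  ac : ∀ b : ℝ, 0 ≤ b → AbsolutelyContinuousOnInterval f 0 b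
  ae : S.SolvesAE f g

theorem solves_solFun (hreg : S.RegularAtZero) (z : ℂ) (w : Phase n) :
    S.Solves (S.solFun z w) (z • S.solFun z w) := by
  refine ⟨fun b hb => ?_, ?_⟩
  · have h := (S.intervalIntegrable_coeff_solFun hreg z w
      hb).absolutelyContinuousOnInterval_primitive (c := 0) left_mem_uIcc
    refine h.of_dist_le ‖z‖ fun x hx y hy => ?_
    rw [uIcc_of_le hb] at hx hy
    rw [S.solFun_eq hreg z w hx.1, S.solFun_eq hreg z w hy.1, dist_add_left, dist_smul₀]
  -- The exceptional null set depends on the interval of integration; countably many intervals `[0,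
  -- N]` suffice.
  · have h : ∀ N : ℕ, ∀ᵐ x : ℝ, x ∈ uIcc (0 : ℝ) N → ∀ c ∈ uIcc (0 : ℝ) N, HasDerivAt
        (fun x => ∫ t in c..x, S.coeff t (S.solFun z w t)) (S.coeff x (S.solFun z w x)) x :=
      fun N => (S.intervalIntegrable_coeff_solFun hreg z w
        N.cast_nonneg).ae_hasDerivAt_integral
    refine (ae_restrict_iff' measurableSet_Ioi).2 ?_
    filter_upwards [ae_all_iff.2 h] with x hx hx0
    obtain ⟨N, hN⟩ := exists_nat_ge x
    have hxN : x ∈ uIcc (0 : ℝ) N := by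
      rw [uIcc_of_le N.cast_nonneg]
      exact ⟨le_of_lt hx0, hN⟩
    refine ⟨z • S.coeff x (S.solFun z w x), ?_, ?_⟩
    · refine (((hx N hxN 0 left_mem_uIcc).const_smul z).const_add w).congr_of_eventuallyEq ?_
      filter_upwards [isOpen_Ioi.mem_nhds hx0] with y hy
      exact S.solFun_eq hreg z w (le_of_lt hy)
    · rw [S.coeff_apply hx0, mulVec_smul, J_mulVec_J_mulVec, Pi.smul_apply, mulVec_smul, smul_neg]

variable {S}

theorem Solves.continuousOn {f g : ℝ → Phase n} (h : S.Solves f g) : ContinuousOn f (Ici 0) := by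
  intro x hx
  have h1 := (h.ac (x + 1) (by linarith [mem_Ici.1 hx])).continuousOn
  rw [uIcc_of_le (by linarith [mem_Ici.1 hx])] at h1
  refine (h1 x ⟨hx, by linarith⟩).mono_of_mem_nhdsWithin ?_
  exact mem_nhdsWithin.2 ⟨Iio (x + 1), isOpen_Iio, by simp, fun y hy => ⟨hy.2, hy.1.le⟩⟩

theorem Solves.add {f g f' g' : ℝ → Phase n} (h : S.Solves f g) (h' : S.Solves f' g') :
    S.Solves (f + f') (g + g') := by
  refine ⟨fun b hb => (h.ac b hb).add (h'.ac b hb), ?_⟩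
  filter_upwards [h.ae, h'.ae] with x hx hx'
  obtain ⟨d, hd, he⟩ := hx
  obtain ⟨d', hd', he'⟩ := hx'
  refine ⟨d + d', hd.add hd', ?_⟩
  rw [mulVec_add, he, he', Pi.add_apply, mulVec_add, neg_add]

theorem Solves.smul {f g : ℝ → Phase n} (c : ℂ) (h : S.Solves f g) :
    S.Solves (c • f) (c • g) := by
  refine ⟨fun b hb => (h.ac b hb).const_smul c, ?_⟩
  filter_upwards [h.ae] with x hx
  obtain ⟨d, hd, he⟩ := hx
  refine ⟨c • d, hd.const_smul c, ?_⟩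
  rw [mulVec_smul, he, Pi.smul_apply, mulVec_smul, smul_neg]

variable (S)

/-- The symplectic form `v* J w`. -/
noncomputable def bracket (v w : Phase n) : ℂ := star v ⬝ᵥ (Matrix.J (Fin n) ℂ *ᵥ w)

theorem conjTranspose_J : (Matrix.J (Fin n) ℂ)ᴴ = -Matrix.J (Fin n) ℂ := by
  simp [Matrix.J, fromBlocks_conjTranspose, fromBlocks_neg]

theorem bracket_eq (v w : Phase n) :
    bracket v w = -(star (Matrix.J (Fin n) ℂ *ᵥ v) ⬝ᵥ w) := by
  rw [bracket, star_mulVec, conjTranspose_J, ← dotProduct_mulVec, neg_mulVec, dotProduct_neg,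
    neg_neg]

theorem hasDerivAt_bracket {f g : ℝ → Phase n} {f' g' : Phase n} {x : ℝ} (hf : HasDerivAt f f' x)
    (hg : HasDerivAt g g' x) :
    HasDerivAt (fun x => bracket (f x) (g x)) (bracket f' (g x) + bracket (f x) g') x := by
  have hJg : HasDerivAt (fun x => Matrix.J (Fin n) ℂ *ᵥ g x) (Matrix.J (Fin n) ℂ *ᵥ g') x :=
    ((LinearMap.toContinuousLinearMap
      (Matrix.toLin' (Matrix.J (Fin n) ℂ))).restrictScalars ℝ).hasFDerivAt.comp_hasDerivAt x hg
  have h := HasDerivAt.fun_sum (u := Finset.univ)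
    (fun i _ => (hasDerivAt_pi.1 hf i).star.fun_mul (hasDerivAt_pi.1 hJg i))
  simpa only [bracket, dotProduct, Pi.star_apply, Finset.sum_add_distrib] using h

theorem absolutelyContinuousOnInterval_bracket {f g : ℝ → Phase n} {a b : ℝ}
    (hf : AbsolutelyContinuousOnInterval f a b) (hg : AbsolutelyContinuousOnInterval g a b) :
    AbsolutelyContinuousOnInterval (fun x => bracket (f x) (g x)) a b := by
  refine AbsolutelyContinuousOnInterval.dotProduct
    (hf.of_dist_le 1 fun x _ y _ => by rw [one_mul, dist_star_star]) ?_
  let L := LinearMap.toContinuousLinearMap (Matrix.toLin' (Matrix.J (Fin n) ℂ))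
  exact hg.of_dist_le ‖L‖ fun x _ y _ => L.lipschitz.dist_le_mul (g x) (g y)

variable {S}

/-- The Lagrange identity. -/
theorem Solves.lagrange {f g φ γ : S.locL2} (hf : S.Solves f φ) (hg : S.Solves g γ) {b : ℝ}
    (hb : 0 ≤ b) :
    bracket (f.1 b) (g.1 b) - bracket (f.1 0) (g.1 0) =
      S.ip (S.trunc b φ) (S.trunc b g) - S.ip (S.trunc b f) (S.trunc b γ) := by
  rw [ip_trunc, ip_trunc,
    ← integral_sub (S.integrableOn_density_locL2 b φ g) (S.integrableOn_density_locL2 b f γ),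
    ← intervalIntegral.integral_of_le hb]
  refine ((absolutelyContinuousOnInterval_bracket (hf.ac b hb)
    (hg.ac b hb)).integral_eq_sub_of_ae_hasDerivAt ?_ ?_).symm
  · have h1 := (ae_restrict_iff' measurableSet_Ioi).1 (hf.ae.and (hg.ae.and S.posSemidef))
    filter_upwards [h1] with x hx hxb
    rw [uIoc_of_le hb] at hxb
    obtain ⟨⟨d, hd, he⟩, ⟨d', hd', he'⟩, hp⟩ := hx hxb.1
    -- Both derivatives enter only through `J f'` and `J g'`, which the equations express by `H`;
    -- then `H` being Hermitian gives the two densities.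
    refine (hasDerivAt_bracket hd hd').congr_deriv ?_
    rw [bracket_eq d, he, bracket, he', star_neg, neg_dotProduct, neg_neg, dotProduct_neg,
      star_mulVec, hp.1.eq, ← dotProduct_mulVec, ← sub_eq_add_neg]
    rfl
  · exact (intervalIntegrable_iff_integrableOn_Ioc_of_le hb).2
      ((S.integrableOn_density_locL2 b φ g).sub (S.integrableOn_density_locL2 b f γ))

/-- The solution of `J y' = -z H y` with `y(0) = w`, as a linear function of `w`. -/
noncomputable def RegularAtZero.sol (hreg : S.RegularAtZero) (z : ℂ) : Phase n →ₗ[ℂ] S.locL2 where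
  toFun w := ⟨S.solFun z w, hreg.mem_locL2 (S.continuousOn_solFun hreg z w)⟩
  map_add' v w := Subtype.ext (funext fun x => map_add (propagator S.coeff z x) v w)
  map_smul' c w := Subtype.ext (funext fun x => map_smul (propagator S.coeff z x) c w)

theorem RegularAtZero.solves_sol (hreg : S.RegularAtZero) (z : ℂ) (w : Phase n) :
    S.Solves (hreg.sol z w) ((z • hreg.sol z w : S.locL2) : ℝ → Phase n) :=
  S.solves_solFun hreg z w

theorem RegularAtZero.sol_zero (hreg : S.RegularAtZero) (z : ℂ) (w : Phase n) :
    (hreg.sol z w).1 0 = w := S.solFun_zero hreg z w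

/-- The Lagrange identity for two solutions. -/
theorem RegularAtZero.lagrange_sol (hreg : S.RegularAtZero) (z₁ z₂ : ℂ) (w₁ w₂ : Phase n) {b : ℝ}
    (hb : 0 ≤ b) :
    bracket ((hreg.sol z₁ w₁).1 b) ((hreg.sol z₂ w₂).1 b) - bracket w₁ w₂ =
      (star z₁ - z₂) * S.ip (S.trunc b (hreg.sol z₁ w₁)) (S.trunc b (hreg.sol z₂ w₂)) := by
  have h := (hreg.solves_sol z₁ w₁).lagrange (hreg.solves_sol z₂ w₂) hb
  rw [hreg.sol_zero, hreg.sol_zero, map_smul, map_smul, ip_smul_left, ip_smul_right] at h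
  rw [h]
  ring

end HalfLineSystem

/-! ### Uniqueness, definiteness and lower bounds for solutions -/

namespace HalfLineSystem

variable {n : ℕ} {S : HalfLineSystem n}

/-- The form is nondegenerate: testing against `J w` gives `‖J w‖² = 0`. -/
theorem eq_zero_of_bracket_left {w : Phase n} (h : ∀ v, bracket v w = 0) : w = 0 := by
  have h1 : Matrix.J (Fin n) ℂ *ᵥ w = 0 := dotProduct_star_self_eq_zero.1
    (h (Matrix.J (Fin n) ℂ *ᵥ w))
  rw [← neg_neg w, ← J_mulVec_J_mulVec w, h1, mulVec_zero, neg_zero]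

theorem eq_zero_of_bracket_right {v : Phase n} (h : ∀ w, bracket v w = 0) : v = 0 := by
  have h1 : star (Matrix.J (Fin n) ℂ *ᵥ v) ⬝ᵥ (Matrix.J (Fin n) ℂ *ᵥ v) = 0 := by
    rw [← neg_eq_zero, ← bracket_eq]
    exact h _
  have h2 := dotProduct_star_self_eq_zero.1 h1
  rw [← neg_neg v, ← J_mulVec_J_mulVec v, h2, mulVec_zero, neg_zero]

theorem bracket_sub_right (u v w : Phase n) : bracket u (v - w) = bracket u v - bracket u w := by
  rw [bracket, mulVec_sub, dotProduct_sub]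
  rfl

@[simp] theorem bracket_zero_left (w : Phase n) : bracket 0 w = 0 := by simp [bracket]

@[simp] theorem bracket_zero_right (w : Phase n) : bracket w 0 = 0 := by simp [bracket]

namespace RegularAtZero

variable (hreg : S.RegularAtZero)
include hreg

/-- By the Lagrange identity, the bracket of a solution at `z` with one at `star z` is constant. So
if the first vanishes at `b`, its initial value is bracket-orthogonal to everything, hence zero;
injectivity gives surjectivity in finite dimension. -/
theorem surjective_solFun (z : ℂ) {b : ℝ} (hb : 0 ≤ b) (v : Phase n) :
    ∃ w, S.solFun z w b = v := by
  let L : Phase n →ₗ[ℂ] Phase n := (propagator S.coeff z b).toLinearMap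
  have hL : Function.Injective L := by
    refine (injective_iff_map_eq_zero L).2 fun w hw => eq_zero_of_bracket_right fun u => ?_
    have h := hreg.lagrange_sol z (star z) w u hb
    rw [sub_self, zero_mul] at h
    have h0 : (hreg.sol z w).1 b = 0 := hw
    rw [h0, bracket_zero_left, zero_sub, neg_eq_zero] at h
    exact h
  exact LinearMap.injective_iff_surjective.1 hL v

/-- Uniqueness of the solution of the initial value problem. -/
theorem eq_solFun {z : ℂ} {f : ℝ → Phase n} (hf : S.Solves f (z • f)) {b : ℝ} (hb : 0 ≤ b) :
    f b = S.solFun z (f 0) b := by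
  let F : S.locL2 := ⟨f, hreg.mem_locL2 hf.continuousOn⟩
  refine sub_eq_zero.1 (eq_zero_of_bracket_left fun v => ?_)
  -- Every test vector at `b` is the value of a solution at `star z`, and its brackets with `f` and
  -- with the constructed solution are both equal to the one at `0`.
  obtain ⟨w, rfl⟩ := hreg.surjective_solFun (star z) hb v
  have h1 := (hreg.solves_sol (star z) w).lagrange (g := F) (γ := z • F) hf hb
  have h2 := hreg.lagrange_sol (star z) z w (f 0) hb
  rw [hreg.sol_zero, map_smul, map_smul, ip_smul_left, ip_smul_right, star_star, sub_self] at h1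
  rw [star_star, sub_self, zero_mul] at h2
  rw [bracket_sub_right]
  exact (sub_eq_zero.1 h1).trans (sub_eq_zero.1 h2).symm ▸ sub_self _

omit hreg in
-- The subspaces of vectors annihilated by `H` almost everywhere on `(0, k]` decrease with `k`, so
-- they stabilize in finite dimension; the final one is annihilated on all of `(0, ∞)`. Passing to a
-- bounded interval makes compactness arguments available.
theorem _root_.HalfLineSystem.IsDefinite.exists_nat (hdef : S.IsDefinite) :
    ∃ N : ℕ, ∀ w : Phase n,
      (∀ᵐ x ∂volume.restrict (Ioc (0 : ℝ) N), S.H x *ᵥ w = 0) → w = 0 := by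
  let D : ℕ →o (Submodule ℂ (Phase n))ᵒᵈ :=
    { toFun := fun k => OrderDual.toDual
        { carrier := {w | ∀ᵐ x ∂volume.restrict (Ioc (0 : ℝ) k), S.H x *ᵥ w = 0}
          zero_mem' := ae_of_all _ fun x => mulVec_zero _
          add_mem' := fun {v w} hv hw => by
            change ∀ᵐ x ∂volume.restrict (Ioc (0 : ℝ) k), S.H x *ᵥ (v + w) = 0
            filter_upwards [hv, hw] with x h1 h2
            rw [mulVec_add, h1, h2, add_zero]
          smul_mem' := fun c w hw => by
            change ∀ᵐ x ∂volume.restrict (Ioc (0 : ℝ) k), S.H x *ᵥ (c • w) = 0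
            filter_upwards [hw] with x h1
            rw [mulVec_smul, h1, smul_zero] }
      monotone' := fun i j hij w hw => ae_restrict_of_ae_restrict_of_subset
        (Ioc_subset_Ioc_right (by exact_mod_cast hij)) hw }
  obtain ⟨N, hN⟩ := IsArtinian.monotone_stabilizes D
  refine ⟨N, fun w hw => hdef w ?_⟩
  have h : ∀ k : ℕ, ∀ᵐ x : ℝ, x ∈ Ioc (0 : ℝ) k → S.H x *ᵥ w = 0 := fun k => by
    refine (ae_restrict_iff' measurableSet_Ioc).1 ?_
    rcases le_total N k with hk | hk
    · have hw' : w ∈ OrderDual.ofDual (D N) := hw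
      rw [hN k hk] at hw'
      exact hw'
    · exact D.monotone' hk hw
  refine (ae_restrict_iff' measurableSet_Ioi).2 ?_
  filter_upwards [ae_all_iff.2 h] with x hx hx0
  obtain ⟨k, hk⟩ := exists_nat_ge x
  exact hx k ⟨hx0, hk⟩

/-- A solution of seminorm zero on an interval where `H` is definite vanishes. -/
theorem eq_zero_of_nsq_trunc_eq_zero {b : ℝ} (hb : ∀ w : Phase n,
    (∀ᵐ x ∂volume.restrict (Ioc (0 : ℝ) b), S.H x *ᵥ w = 0) → w = 0) {z : ℂ} {w : Phase n}
    (hw : S.nsq (S.trunc b (hreg.sol z w)) = 0) : w = 0 := by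
  have h1 := S.ae_mulVec_eq_zero_of_energy_eq_zero (S.trunc b (hreg.sol z w)).2.1 (by
    rw [energy_eq_ofReal_nsq, hw, ENNReal.ofReal_zero])
  have h2 := (ae_restrict_iff' measurableSet_Ioi).1 h1
  refine hb w ((ae_restrict_iff' measurableSet_Ioc).2 ?_)
  have h3 : ∀ᵐ x : ℝ, x ∈ Ioc 0 b → S.H x *ᵥ S.solFun z w x = 0 := by
    filter_upwards [h2] with x hx hxb
    have h4 : (S.trunc b (hreg.sol z w)).1 x = S.solFun z w x := indicator_of_mem hxb _
    rw [← h4]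
    exact hx hxb.1
  filter_upwards [h3] with x hx hxb
  -- Since `H y = 0` almost everywhere, the integral equation makes `y` constant on the interval, so
  -- definiteness applies to `w` itself.
  have h5 : S.solFun z w x = w := by
    rw [S.solFun_eq hreg z w hxb.1.le, intervalIntegral.integral_zero_ae, smul_zero, add_zero]
    filter_upwards [h3] with t ht htx
    rw [uIoc_of_le hxb.1.le] at htx
    rw [S.coeff_apply htx.1, ht ⟨htx.1, htx.2.trans hxb.2⟩, mulVec_zero]
  rw [h5] at hx
  exact hx hxb

omit hreg in
theorem _root_.HalfLineSystem.norm_density_le (S : HalfLineSystem n) (x : ℝ) (v w : Phase n) :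
    ‖S.density x v w‖ ≤ (∑ i, ∑ j, ‖S.H x i j‖) * (‖v‖ * ‖w‖) := by
  simp only [density, dotProduct, mulVec, Finset.mul_sum, Finset.sum_mul]
  refine (norm_sum_le _ _).trans (Finset.sum_le_sum fun i _ => (norm_sum_le _ _).trans
    (Finset.sum_le_sum fun j _ => ?_))
  rw [norm_mul, norm_mul, Pi.star_apply, norm_star]
  calc ‖v i‖ * (‖S.H x i j‖ * ‖w j‖) = ‖S.H x i j‖ * (‖v i‖ * ‖w j‖) := by ring
    _ ≤ _ := by
      gcongr
      · exact norm_le_pi_norm v i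
      · exact norm_le_pi_norm w j

open Filter Topology in
theorem continuous_nsq_trunc_sol (b : ℝ) :
    Continuous fun p : ℂ × Phase n => S.nsq (S.trunc b (hreg.sol p.1 p.2)) := by
  simp only [nsq_trunc_eq_integral]
  refine continuous_iff_continuousAt.2 fun p => ?_
  set C := ∑' k, propagatorBound S.coeff (‖p.1‖ + 1) b k
  have hi := S.intervalIntegrable_coeff hreg
  have hsol : ∀ q : ℂ × Phase n, ((hreg.sol q.1 q.2 : S.locL2) : ℝ → Phase n) =
    S.solFun q.1 q.2 := fun q => rfl
  refine continuousAt_of_dominated (bound := fun x =>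
    (∑ i, ∑ j, ‖S.H x i j‖) * ((C * (‖p.2‖ + 1)) * (C * (‖p.2‖ + 1))))
    (Eventually.of_forall fun q => (S.integrableOn_density_locL2 b _ _).re.aestronglyMeasurable)
    ?_ ?_ ?_
  · have h1 : ∀ᶠ q : ℂ × Phase n in 𝓝 p, ‖q.1‖ ≤ ‖p.1‖ + 1 ∧ ‖q.2‖ ≤ ‖p.2‖ + 1 := by
      refine ((continuous_fst.norm.continuousAt.eventually_lt continuousAt_const ?_).and
        (continuous_snd.norm.continuousAt.eventually_lt continuousAt_const ?_)).mono
        fun q hq => ⟨hq.1.le, hq.2.le⟩ <;> simp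
    filter_upwards [h1] with q hq
    filter_upwards [ae_restrict_mem measurableSet_Ioc] with x hx
    have hb : ‖S.solFun q.1 q.2 x‖ ≤ C * (‖p.2‖ + 1) := by
      refine ((propagator S.coeff q.1 x).le_opNorm q.2).trans ?_
      have h2 := norm_propagator_le hi hq.1 hx.1.le hx.2
      exact mul_le_mul h2 hq.2 (norm_nonneg _) ((norm_nonneg _).trans h2)
    refine (Complex.abs_re_le_norm _).trans ((S.norm_density_le x _ _).trans ?_)
    rw [hsol]
    have hC := (norm_nonneg _).trans hb
    gcongr
  · exact (integrable_finsetSum _ fun i _ => integrable_finsetSum _ fun j _ =>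
      (hreg.integrableOn b i j).norm).mul_const _
  · filter_upwards [ae_restrict_mem measurableSet_Ioc] with x hx
    have hc : Continuous fun q : ℂ × Phase n => S.solFun q.1 q.2 x :=
      ((differentiable_propagator hi hx.1.le).continuous.comp continuous_fst).clm_apply
        continuous_snd
    simp only [hsol]
    refine Continuous.continuousAt (Complex.continuous_re.comp ?_)
    simp only [density]
    exact hc.star.dotProduct (continuous_const.matrix_mulVec hc)

omit hreg in
theorem _root_.HalfLineSystem.nsq_smul (c : ℂ) (f : S.preL2) :
    S.nsq (c • f) = ‖c‖ ^ 2 * S.nsq f := by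
  rw [nsq, ip_smul_left, ip_smul_right, ← mul_assoc, ip_self, Complex.star_def,
    Complex.conj_mul', ← Complex.ofReal_pow, ← Complex.ofReal_mul, Complex.ofReal_re]

/-- A lower bound for the norms of solutions that is uniform on compact sets of spectral
parameters. -/
theorem exists_le_nsq_trunc_sol {b : ℝ} (hb : ∀ w : Phase n,
    (∀ᵐ x ∂volume.restrict (Ioc (0 : ℝ) b), S.H x *ᵥ w = 0) → w = 0) {K : Set ℂ}
    (hK : IsCompact K) :
    ∃ δ : ℝ, 0 < δ ∧ ∀ z ∈ K, ∀ w : Phase n, δ * ‖w‖ ^ 2 ≤ S.nsq (S.trunc b (hreg.sol z w)) := by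
  -- The norm is continuous and positive on the compact product of `K` with the unit sphere;
  -- homogeneity extends the bound to all `w`.
  obtain ⟨δ, hδ, h⟩ := (hK.prod (isCompact_sphere (0 : Phase n) 1)).exists_forall_le'
    (hreg.continuous_nsq_trunc_sol b).continuousOn (a := 0) fun p hp => by
      refine lt_of_le_of_ne (S.nsq_nonneg _) fun h0 => ?_
      have h1 := hreg.eq_zero_of_nsq_trunc_eq_zero hb h0.symm
      have h2 := mem_sphere_zero_iff_norm.1 hp.2
      rw [h1, norm_zero] at h2
      exact zero_ne_one h2
  refine ⟨δ, hδ, fun z hz w => ?_⟩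
  rcases eq_or_ne w 0 with rfl | hw
  · simpa using S.nsq_nonneg _
  have hw' : ‖w‖ ≠ 0 := norm_ne_zero_iff.2 hw
  have h1 := h (z, ((‖w‖ : ℂ)⁻¹) • w) ⟨hz, by
    rw [mem_sphere_zero_iff_norm, norm_smul, norm_inv, Complex.norm_real, norm_norm,
      inv_mul_cancel₀ hw']⟩
  simp only [map_smul, nsq_smul, norm_inv, Complex.norm_real, norm_norm] at h1
  calc δ * ‖w‖ ^ 2 ≤ ((‖w‖⁻¹) ^ 2 * S.nsq (S.trunc b (hreg.sol z w))) * ‖w‖ ^ 2 := by gcongr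
    _ = _ := by field_simp

/-- The initial values of the solutions of `J y' = -z H y` that are in `L²_H(0, ∞)`. -/
noncomputable def l2Initial (hreg : S.RegularAtZero) (z : ℂ) : Submodule ℂ (Phase n) :=
  S.preL2.comap (S.locL2.subtype ∘ₗ hreg.sol z)

/-- The solutions of `J y' = -z H y` that are in `L²_H(0, ∞)`. -/
noncomputable def l2Sol (hreg : S.RegularAtZero) (z : ℂ) : hreg.l2Initial z →ₗ[ℂ] S.preL2 :=
  (S.locL2.subtype ∘ₗ hreg.sol z).restrict fun _ h => h

/-- Definiteness makes the passage to classes injective on solutions, so a square-integrable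
solution is determined by its class in the kernel. -/
theorem rank_l2Initial_le (hdef : S.IsDefinite) (z : ℂ) :
    Module.rank ℂ (hreg.l2Initial z) ≤ Module.rank ℂ (S.maximalKer z) := by
  let L := hreg.l2Sol z
  have hL : ∀ w, (S.nullSpace.mkQ ∘ₗ L) w ∈ S.maximalKer z := fun w => by
    refine ⟨L w, z • L w, rfl, rfl, fun a b ha hab => ?_, (hreg.solves_sol z w).ae⟩
    refine ((hreg.solves_sol z w).ac b (ha.le.trans hab)).mono ?_
    rw [uIcc_of_le hab, uIcc_of_le (ha.le.trans hab)]
    exact Icc_subset_Icc_left ha.le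
  refine LinearMap.rank_le_of_injective ((S.nullSpace.mkQ ∘ₗ L).codRestrict _ hL)
    ((injective_iff_map_eq_zero _).2 fun w hw => Subtype.ext ?_)
  have h1 : S.nullSpace.mkQ (L w) = 0 := congrArg Subtype.val hw
  rw [Submodule.mkQ_apply, Submodule.Quotient.mk_eq_zero] at h1
  have h2 : S.energy (L w) = 0 := h1
  rw [energy_eq_ofReal_nsq, ENNReal.ofReal_eq_zero] at h2
  obtain ⟨N, hN⟩ := hdef.exists_nat
  exact hreg.eq_zero_of_nsq_trunc_eq_zero hN (le_antisymm ((S.nsq_trunc_le (L w) N).trans h2)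
    (S.nsq_nonneg _))

end RegularAtZero

end HalfLineSystem

/-! ### Dimension of the space of square-integrable solutions -/

namespace HalfLineSystem

variable {n : ℕ} (S : HalfLineSystem n)

/-- The linear functional `g ↦ ⟨f, g⟩`. -/
noncomputable def ipLin (f : S.preL2) : S.preL2 →ₗ[ℂ] ℂ where
  toFun := S.ip f
  map_add' := S.ip_add_right f
  map_smul' c := S.ip_smul_right c f

theorem ip_eq_zero_comm {f g : S.preL2} : S.ip f g = 0 ↔ S.ip g f = 0 := by
  rw [← S.star_ip f g, star_eq_zero]

theorem ip_trunc_trunc_of_le {a b : ℝ} (hab : a ≤ b) (f g : S.locL2) :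
    S.ip (S.trunc b f) (S.trunc a g) = S.ip (S.trunc a f) (S.trunc a g) := by
  unfold ip
  refine integral_congr_ae (ae_of_all _ fun x => ?_)
  by_cases hx : x ∈ Ioc 0 a
  · have hx' : x ∈ Ioc 0 b := ⟨hx.1, hx.2.trans hab⟩
    simp [trunc, hx, hx']
  · simp [trunc, hx]

theorem nsq_sub (f g : S.preL2) : S.nsq (f - g) = S.nsq f - 2 * (S.ip g f).re + S.nsq g := by
  have h := congrArg Complex.re (S.star_ip g f)
  simp only [nsq, ip_sub_left, ip_sub_right, Complex.sub_re, Complex.star_def,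
    Complex.conj_re] at h ⊢
  linarith

variable {S}

namespace RegularAtZero

variable (hreg : S.RegularAtZero)

include hreg in
/-- Orthogonal projection onto the space of truncated solutions. -/
theorem exists_orthogonal_sol {b : ℝ} (hb : ∀ w : Phase n,
    (∀ᵐ x ∂volume.restrict (Ioc (0 : ℝ) b), S.H x *ᵥ w = 0) → w = 0) (z : ℂ) (g : S.preL2) :
    ∃ p, ∀ v, S.ip (S.trunc b (hreg.sol z v)) (g - S.trunc b (hreg.sol z p)) = 0 := by
  let T := S.trunc b ∘ₗ hreg.sol z
  have hext : ∀ f : S.preL2, (∀ i, S.ip (T (Pi.single i 1)) f = 0) → ∀ v, S.ip (T v) f = 0 := by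
    intro f hf v
    have h : S.ipLin f ∘ₗ T = 0 := by
      refine LinearMap.pi_ext' fun i => LinearMap.ext_ring ?_
      exact S.ip_eq_zero_comm.1 (hf i)
    exact S.ip_eq_zero_comm.1 (LinearMap.congr_fun h v)
  let Λ : Phase n →ₗ[ℂ] Phase n := LinearMap.pi fun i => S.ipLin (T (Pi.single i 1)) ∘ₗ T
  -- `Λ` expresses the Gram matrix of the truncated solutions, which is invertible since only the
  -- zero solution has seminorm zero.
  have hΛ : Function.Injective Λ := (injective_iff_map_eq_zero Λ).2 fun p hp => by
    have h := hext (T p) (fun i => congrFun hp i) p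
    exact hreg.eq_zero_of_nsq_trunc_eq_zero hb (congrArg Complex.re h)
  obtain ⟨p, hp⟩ := LinearMap.injective_iff_surjective.1 hΛ fun i => S.ip (T (Pi.single i 1)) g
  refine ⟨p, hext _ fun i => ?_⟩
  rw [ip_sub_right]
  exact sub_eq_zero.2 (congrFun hp i).symm

include hreg in
-- With `e = y - s` orthogonal to the solutions at `z₀`, the equation `J h' = -H (z₀* h + e)` has a
-- solution vanishing at both ends, where `z₀*` is the conjugate. The Lagrange identity of `h` with
-- itself gives `|Im z₀| ‖h‖ ≤ ‖e‖`, and with `y` gives `⟨e, y⟩ = (z - z₀) ⟨h, y⟩`; finally `‖e‖² =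
-- ⟨e, y⟩`.
theorem nsq_trunc_le_of_orthogonal {z z₀ : ℂ} (hz₀ : z₀.im ≠ 0) (hz : z ≠ star z₀) {b : ℝ}
    (hb : 0 ≤ b) {w p : Phase n} (horth : ∀ v, S.ip (S.trunc b (hreg.sol z₀ v))
      (S.trunc b (hreg.sol z w - hreg.sol z₀ p)) = 0) :
    |z₀.im| * √(S.nsq (S.trunc b (hreg.sol z w - hreg.sol z₀ p))) ≤
      ‖z - z₀‖ * √(S.nsq (S.trunc b (hreg.sol z w))) := by
  have hz₁ : z - star z₀ ≠ 0 := sub_ne_zero.2 hz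
  have hz₂ : z₀ - star z₀ ≠ 0 := fun h => hz₀ (by
    have := congrArg Complex.im h
    simp only [Complex.sub_im, Complex.star_def, Complex.conj_im, Complex.zero_im] at this
    linarith)
  set y := hreg.sol z w with hy
  set s := hreg.sol z₀ p with hs
  set e := y - s with he
  -- The first two terms of `h` form a particular solution of the inhomogeneous equation; `q` is the
  -- initial value of the homogeneous correction making `h(0) = 0`.
  set q : Phase n := -((z - star z₀)⁻¹ • w + (-(z₀ - star z₀)⁻¹) • p) with hq
  set r := hreg.sol (star z₀) q with hr
  set h : S.locL2 := (z - star z₀)⁻¹ • y + (-(z₀ - star z₀)⁻¹) • s + r with hh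
  have hφ : star z₀ • h + e = (z - star z₀)⁻¹ • (z • y) + (-(z₀ - star z₀)⁻¹) • (z₀ • s) +
      star z₀ • r := by
    have h1 : (z - star z₀)⁻¹ * z = star z₀ * (z - star z₀)⁻¹ + 1 := by
      field_simp
      ring
    have h2 : (z₀ - star z₀)⁻¹ * z₀ = star z₀ * (z₀ - star z₀)⁻¹ + 1 := by
      field_simp
      ring
    rw [hh, he, smul_smul, smul_smul, h1, neg_mul, h2]
    module
  have hsol : S.Solves h ((star z₀ • h + e : S.locL2) : ℝ → Phase n) := by
    rw [hφ]
    exact (((hreg.solves_sol z w).smul _).add ((hreg.solves_sol z₀ p).smul _)).add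
      (hreg.solves_sol (star z₀) q)
  have h0 : h.1 0 = 0 := by
    have h1 : h.1 0 = (z - star z₀)⁻¹ • y.1 0 + (-(z₀ - star z₀)⁻¹) • s.1 0 + r.1 0 := rfl
    rw [h1, hy, hs, hr, hreg.sol_zero, hreg.sol_zero, hreg.sol_zero, hq, add_neg_cancel]
  -- Here orthogonality enters: the bracket of `h(b)` with any solution at `z₀` is minus the scalar
  -- product of that solution with `e`.
  have hhb : h.1 b = 0 := by
    refine eq_zero_of_bracket_left fun v => ?_
    obtain ⟨v, rfl⟩ := hreg.surjective_solFun z₀ hb v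
    have h1 := (hreg.solves_sol z₀ v).lagrange hsol hb
    rw [h0, bracket_zero_right, sub_zero, map_smul, map_add _ (star z₀ • h), map_smul, ip_smul_left,
      ip_add_right, ip_smul_right, horth v, add_zero, sub_self] at h1
    exact h1
  have h2 := hsol.lagrange (hreg.solves_sol z w) hb
  have h3 := hsol.lagrange hsol hb
  rw [h0, hhb, bracket_zero_left, bracket_zero_left, sub_self] at h2
  rw [h0, hhb, bracket_zero_left, sub_self] at h3
  rw [← hy] at h2
  simp only [map_add, map_smul, ip_add_left, ip_add_right, ip_smul_left, ip_smul_right,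
    star_star] at h2 h3
  set Y := S.trunc b y
  set E := S.trunc b e
  set Z := S.trunc b h
  have h4 : |z₀.im| * S.nsq Z ≤ ‖S.ip Z E‖ := by
    rw [← S.star_ip Z E, S.ip_self] at h3
    have h5 := congrArg Complex.im h3
    simp only [Complex.star_def, Complex.sub_im, Complex.add_im, Complex.im_mul_ofReal,
      Complex.conj_im, Complex.zero_im] at h5
    have h6 : z₀.im * S.nsq Z = (S.ip Z E).im := by linarith
    rw [← abs_of_nonneg (S.nsq_nonneg Z), ← abs_mul, h6]
    exact Complex.abs_im_le_norm _
  have h5 : S.ip E Y = (z - z₀) * S.ip Z Y := by linear_combination -h2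
  have h6 : S.nsq E ≤ ‖z - z₀‖ * (√(S.nsq Z) * √(S.nsq Y)) := by
    have h7 : S.ip E E = S.ip E Y := by
      have h8 : S.ip E (S.trunc b s) = 0 := S.ip_eq_zero_comm.1 (horth p)
      have h9 : E = Y - S.trunc b s := map_sub _ _ _
      rw [show S.ip E E = S.ip E (Y - S.trunc b s) by rw [← h9], ip_sub_right, h8, sub_zero]
    calc S.nsq E ≤ ‖S.ip E E‖ := Complex.re_le_norm _
      _ = ‖z - z₀‖ * ‖S.ip Z Y‖ := by rw [h7, h5, norm_mul]
      _ ≤ _ := by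
        gcongr
        exact S.norm_ip_le _ _
  have h7 := h4.trans (S.norm_ip_le _ _)
  have hZ := Real.sq_sqrt (S.nsq_nonneg Z)
  have hE := Real.sq_sqrt (S.nsq_nonneg E)
  have h8 : |z₀.im| * √(S.nsq Z) ≤ √(S.nsq E) := by
    rcases (Real.sqrt_nonneg (S.nsq Z)).eq_or_lt with h | h
    · rw [← h, mul_zero]
      exact Real.sqrt_nonneg _
    · refine le_of_mul_le_mul_right ?_ h
      rw [mul_assoc, ← sq, hZ, mul_comm √_]
      exact h7
  rcases (Real.sqrt_nonneg (S.nsq E)).eq_or_lt with h | h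
  · rw [← h, mul_zero]
    positivity
  · refine le_of_mul_le_mul_right ?_ h
    calc |z₀.im| * √(S.nsq E) * √(S.nsq E) = |z₀.im| * S.nsq E := by rw [mul_assoc, ← sq, hE]
      _ ≤ |z₀.im| * (‖z - z₀‖ * (√(S.nsq Z) * √(S.nsq Y))) := by gcongr
      _ = (|z₀.im| * √(S.nsq Z)) * (‖z - z₀‖ * √(S.nsq Y)) := by ring
      _ ≤ √(S.nsq E) * (‖z - z₀‖ * √(S.nsq Y)) := by gcongr
      _ = _ := by ring

include hreg in
theorem continuous_nsq_trunc_sol_right (b : ℝ) (z : ℂ) :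
    Continuous fun w => S.nsq (S.trunc b (hreg.sol z w)) :=
  Continuous.comp (g := fun p : ℂ × Phase n => S.nsq (S.trunc b (hreg.sol p.1 p.2)))
    (f := fun w => (z, w)) (hreg.continuous_nsq_trunc_sol b) (Continuous.prodMk_right z)

open Filter Topology in
include hreg in
-- The projections of `y` onto the solutions at `z₀` on growing intervals have bounded initial
-- values, so they subconverge to a square-integrable solution. It is orthogonal to `y`, which
-- forces the norms of the projections to `0`; the finite-interval estimate then gives `|Im z₀| ‖y‖
-- ≤ |z - z₀| ‖y‖` in the limit.
theorem eq_zero_of_orthogonal (hdef : S.IsDefinite) {z z₀ : ℂ} (hz : ‖z - z₀‖ < |z₀.im|)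
    (w : hreg.l2Initial z) (hw : ∀ v, S.ip (hreg.l2Sol z₀ v) (hreg.l2Sol z w) = 0) : w = 0 := by
  obtain ⟨N, hN⟩ := hdef.exists_nat
  have hz₀ : z₀.im ≠ 0 := abs_pos.1 ((norm_nonneg _).trans_lt hz)
  have hzs : z ≠ star z₀ := by
    rintro rfl
    have h := (Complex.abs_im_le_norm _).trans_lt hz
    have h2 : (star z₀ - z₀).im = -(2 * z₀.im) := by simp; ring
    rw [h2, abs_neg, abs_mul, abs_two] at h
    linarith [abs_nonneg z₀.im]
  set y := hreg.l2Sol z w with hy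
  have hyT : ∀ b, S.trunc b ⟨y, S.preL2_le_locL2 y.2⟩ = S.trunc b (hreg.sol z w) := fun _ => rfl
  have hNb : ∀ b : ℝ, N ≤ b → ∀ w : Phase n,
      (∀ᵐ x ∂volume.restrict (Ioc (0 : ℝ) b), S.H x *ᵥ w = 0) → w = 0 := fun b hb w hw =>
    hN w (ae_restrict_of_ae_restrict_of_subset (Ioc_subset_Ioc_right hb) hw)
  -- The shift by `N` keeps all intervals long enough for `H` to be definite on them.
  have hle : ∀ k : ℕ, (N : ℝ) ≤ ((k + N : ℕ) : ℝ) := fun k => by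
    exact_mod_cast Nat.le_add_left N k
  choose p hp using fun k : ℕ => hreg.exists_orthogonal_sol (hNb _ (hle k)) z₀ y
  set Y : ℕ → S.preL2 := fun k => S.trunc ((k + N : ℕ) : ℝ) (hreg.sol z w) with hY
  set s : ℕ → S.preL2 := fun k => S.trunc ((k + N : ℕ) : ℝ) (hreg.sol z₀ (p k)) with hs
  have horth : ∀ k v, S.ip (S.trunc ((k + N : ℕ) : ℝ) (hreg.sol z₀ v)) (Y k - s k) = 0 := by
    intro k v
    rw [← hp k v, ip_sub_right, ip_sub_right, S.ip_trunc_left _ _ y, hyT]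
  have hsy : ∀ k, S.ip (s k) y = S.nsq (s k) := fun k => by
    rw [← S.ip_self, ← sub_eq_zero, ← ip_sub_right]
    exact hp k (p k)
  have hsY : ∀ k, S.ip (s k) (Y k) = S.nsq (s k) := fun k => by
    rw [← S.ip_self, ← sub_eq_zero, ← ip_sub_right]
    exact horth k (p k)
  have hpyth : ∀ k, S.nsq (Y k - s k) = S.nsq (Y k) - S.nsq (s k) := fun k => by
    rw [nsq_sub, hsY, Complex.ofReal_re]
    ring
  have hYy : ∀ k, S.nsq (Y k) ≤ S.nsq y := fun k => S.nsq_trunc_le y _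
  have hsle : ∀ k, S.nsq (s k) ≤ S.nsq y := fun k => by
    linarith [hYy k, hpyth k, S.nsq_nonneg (Y k - s k)]
  have hkey : ∀ k, |z₀.im| ^ 2 * S.nsq (Y k - s k) ≤ ‖z - z₀‖ ^ 2 * S.nsq y := fun k => by
    have h := hreg.nsq_trunc_le_of_orthogonal hz₀ hzs (b := ((k + N : ℕ) : ℝ))
      (Nat.cast_nonneg _) (w := w) (p := p k) (fun v => by rw [map_sub]; exact horth k v)
    rw [map_sub] at h
    have h2 := mul_self_le_mul_self (by positivity) h
    have h3 := Real.mul_self_sqrt (S.nsq_nonneg (Y k - s k))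
    have h4 := Real.mul_self_sqrt (S.nsq_nonneg (Y k))
    calc |z₀.im| ^ 2 * S.nsq (Y k - s k)
        = (|z₀.im| * √(S.nsq (Y k - s k))) * (|z₀.im| * √(S.nsq (Y k - s k))) := by
          rw [mul_mul_mul_comm, h3, sq]
      _ ≤ _ := h2
      _ = ‖z - z₀‖ ^ 2 * S.nsq (Y k) := by rw [mul_mul_mul_comm, h4, sq]
      _ ≤ _ := by gcongr; exact hYy k
  -- a limit of the initial values of the projections
  obtain ⟨δ, hδ, hδw⟩ := hreg.exists_le_nsq_trunc_sol hN (isCompact_singleton (x := z₀))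
  have hbdd : ∀ k, p k ∈ Metric.closedBall (0 : Phase n) √(S.nsq y / δ) := fun k => by
    rw [mem_closedBall_zero_iff]
    refine Real.le_sqrt_of_sq_le ((le_div_iff₀' hδ).2 ?_)
    exact (hδw z₀ rfl _).trans ((S.nsq_trunc_mono _ (hle k)).trans (hsle k))
  obtain ⟨p₀, -, φ, hφ, hlim⟩ := (isCompact_closedBall (0 : Phase n) _).tendsto_subseq hbdd
  have hφN : ∀ m : ℕ, ∀ᶠ k in atTop, (m : ℝ) ≤ ((φ k + N : ℕ) : ℝ) := fun m => by
    filter_upwards [hφ.tendsto_atTop.eventually_ge_atTop m] with k hk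
    exact_mod_cast hk.trans (Nat.le_add_right _ _)
  have hp₀ : p₀ ∈ hreg.l2Initial z₀ := by
    refine S.mem_preL2_of_nsq_trunc_le (hreg.sol z₀ p₀) (C := S.nsq y) fun m => ?_
    have h1 : Tendsto (fun k => S.nsq (S.trunc m (hreg.sol z₀ (p (φ k))))) atTop
        (𝓝 (S.nsq (S.trunc m (hreg.sol z₀ p₀)))) :=
      ((hreg.continuous_nsq_trunc_sol_right m z₀).tendsto p₀).comp hlim
    refine le_of_tendsto h1 ?_
    filter_upwards [hφN m] with k hk
    exact (S.nsq_trunc_mono _ hk).trans (hsle _)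
  set s₀ := hreg.l2Sol z₀ ⟨p₀, hp₀⟩ with hs₀
  have hs₀T : ∀ b, S.trunc b ⟨s₀, S.preL2_le_locL2 s₀.2⟩ = S.trunc b (hreg.sol z₀ p₀) :=
    fun _ => rfl
  have hys₀ : S.ip y s₀ = 0 := S.ip_eq_zero_comm.1 (hw _)
  set D := √(S.nsq y) with hD
  -- Use `‖s‖² = ⟨s, y⟩` and cut at a fixed `m`: the tail of `y` is small uniformly in `k`, while on
  -- `(0, m]` the projections converge to `s₀`, whose product with `y` there is minus that of the
  -- tails.
  have hsmall : Tendsto (fun k => S.nsq (s (φ k))) atTop (𝓝 0) := by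
    have h1 : Tendsto (fun m : ℕ => D * √(S.nsq (y - S.trunc m ⟨y, S.preL2_le_locL2 y.2⟩)) +
        D * √(S.nsq (s₀ - S.trunc m ⟨s₀, S.preL2_le_locL2 s₀.2⟩))) atTop (𝓝 0) := by
      have h2 := (S.tendsto_nsq_sub_trunc y).sqrt.const_mul D
      have h3 := (S.tendsto_nsq_sub_trunc s₀).sqrt.const_mul D
      simpa using h2.add h3
    refine Metric.tendsto_nhds.2 fun ε hε => ?_
    obtain ⟨m, hm⟩ := (h1.eventually_lt_const (half_pos hε)).exists
    have h4 : Tendsto (fun k => ‖S.ip y (S.trunc m (hreg.sol z₀ (p (φ k))))‖) atTop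
        (𝓝 ‖S.ip y (S.trunc m (hreg.sol z₀ p₀))‖) :=
      (((S.ipLin y ∘ₗ S.trunc m ∘ₗ hreg.sol z₀).continuous_of_finiteDimensional.tendsto
        p₀).comp hlim).norm
    have h5 : ‖S.ip y (S.trunc m (hreg.sol z₀ p₀))‖ ≤
        D * √(S.nsq (s₀ - S.trunc m ⟨s₀, S.preL2_le_locL2 s₀.2⟩)) := by
      refine le_trans (le_of_eq ?_) (S.norm_ip_le y _)
      rw [ip_sub_right, hys₀, zero_sub, norm_neg, hs₀T]
    have h6 := h4.eventually_lt_const (lt_add_of_pos_right _ (half_pos hε))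
    filter_upwards [h6, hφN m] with k hk hkm
    rw [Real.dist_eq, sub_zero, abs_of_nonneg (S.nsq_nonneg _)]
    have h7 : S.ip (s (φ k)) (S.trunc m (hreg.sol z w)) =
        star (S.ip y (S.trunc m (hreg.sol z₀ (p (φ k))))) := by
      rw [S.star_ip, S.ip_trunc_left _ _ y, hyT]
      exact S.ip_trunc_trunc_of_le hkm _ _
    have h8 : S.nsq (s (φ k)) = ‖S.ip (s (φ k)) (y - S.trunc m (hreg.sol z w)) +
        S.ip (s (φ k)) (S.trunc m (hreg.sol z w))‖ := by
      rw [← ip_add_right, sub_add_cancel, hsy, Complex.norm_real, Real.norm_eq_abs,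
        abs_of_nonneg (S.nsq_nonneg _)]
    have h9 : ‖S.ip (s (φ k)) (y - S.trunc m (hreg.sol z w))‖ ≤
        D * √(S.nsq (y - S.trunc m (hreg.sol z w))) := by
      refine (S.norm_ip_le _ _).trans ?_
      exact mul_le_mul_of_nonneg_right (Real.sqrt_le_sqrt (hsle _)) (Real.sqrt_nonneg _)
    have h10 := norm_add_le (S.ip (s (φ k)) (y - S.trunc m (hreg.sol z w)))
      (S.ip (s (φ k)) (S.trunc m (hreg.sol z w)))
    rw [← h8, h7, norm_star] at h10
    rw [hyT] at hm
    linarith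
  have hYlim : Tendsto (fun k => S.nsq (Y (φ k))) atTop (𝓝 (S.nsq y)) := by
    have h1 : ∀ m : ℕ, S.nsq y - S.nsq (y - S.trunc m ⟨y, S.preL2_le_locL2 y.2⟩) =
        S.nsq (S.trunc m (hreg.sol z w)) := fun m => by
      rw [nsq_sub, ip_trunc_left, hyT, ip_self, Complex.ofReal_re]
      ring
    have h2 := (tendsto_const_nhds (x := S.nsq y)).sub (S.tendsto_nsq_sub_trunc y)
    simp only [h1, sub_zero] at h2
    exact h2.comp ((tendsto_add_atTop_nat N).comp hφ.tendsto_atTop)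
  have hfin : |z₀.im| ^ 2 * S.nsq y ≤ ‖z - z₀‖ ^ 2 * S.nsq y := by
    have h1 := ((hYlim.sub hsmall).const_mul (|z₀.im| ^ 2))
    rw [sub_zero] at h1
    refine le_of_tendsto h1 (Eventually.of_forall fun k => ?_)
    rw [← hpyth]
    exact hkey _
  have hy0 : S.nsq y = 0 := by
    refine le_antisymm ?_ (S.nsq_nonneg y)
    by_contra! h
    have h2 := le_of_mul_le_mul_right hfin h
    have h3 : ‖z - z₀‖ ^ 2 < |z₀.im| ^ 2 := by gcongr
    linarith
  refine Subtype.ext (hreg.eq_zero_of_nsq_trunc_eq_zero hN (z := z) ?_)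
  exact le_antisymm ((S.nsq_trunc_le y N).trans hy0.le) (S.nsq_nonneg _)

include hreg in
/-- The dimension of the space of solutions in `L²_H(0, ∞)` is upper semicontinuous. -/
theorem finrank_l2Initial_le (hdef : S.IsDefinite) {z z₀ : ℂ} (hz : ‖z - z₀‖ < |z₀.im|) :
    Module.finrank ℂ (hreg.l2Initial z) ≤ Module.finrank ℂ (hreg.l2Initial z₀) := by
  by_contra! hlt
  let B := Module.finBasis ℂ (hreg.l2Initial z₀)
  let L : hreg.l2Initial z →ₗ[ℂ] (Fin (Module.finrank ℂ (hreg.l2Initial z₀)) → ℂ) :=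
    LinearMap.pi fun i => S.ipLin (hreg.l2Sol z₀ (B i)) ∘ₗ hreg.l2Sol z
  -- Too many solutions at `z` would leave a nonzero one orthogonal to a basis of those at `z₀`.
  have hL : LinearMap.ker L ≠ ⊥ := LinearMap.ker_ne_bot_of_finrank_lt (by simpa using hlt)
  obtain ⟨w, hw, hw0⟩ := Submodule.exists_mem_ne_zero_of_ne_bot hL
  refine hw0 (hreg.eq_zero_of_orthogonal hdef hz w fun v => ?_)
  have h : S.ipLin (hreg.l2Sol z w) ∘ₗ hreg.l2Sol z₀ = 0 := B.ext fun i =>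
    S.ip_eq_zero_comm.1 (congrFun (LinearMap.mem_ker.1 hw) i)
  exact S.ip_eq_zero_comm.1 (LinearMap.congr_fun h v)

include hreg in
-- The sign of `σ` selects the half-plane. The set where the bound holds is open, and also
-- relatively closed because the radius `|Im z₀|` does not shrink near a point of the open
-- half-plane.
theorem finrank_l2Initial_le_of_im_pos (hdef : S.IsDefinite) {k : ℕ} {σ : ℝ} (hσ : σ ≠ 0)
    (h0 : Module.finrank ℂ (hreg.l2Initial (σ * Complex.I)) ≤ k) {z : ℂ} (hz : 0 < σ * z.im) :
    Module.finrank ℂ (hreg.l2Initial z) ≤ k := by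
  let U : Set ℂ := {z | 0 < σ * z.im}
  let u : Set ℂ := {z | 0 < σ * z.im ∧ Module.finrank ℂ (hreg.l2Initial z) ≤ k}
  have hmem : ∀ z₀ ∈ u, ∀ z, ‖z - z₀‖ < |z₀.im| → z ∈ u := by
    intro z₀ h₀ z hz
    refine ⟨?_, (hreg.finrank_l2Initial_le hdef hz).trans h₀.2⟩
    have h1 : |z.im - z₀.im| < |z₀.im| := (Complex.abs_im_le_norm (z - z₀)).trans_lt hz
    rcases pos_and_pos_or_neg_and_neg_of_mul_pos h₀.1 with ⟨hs, hi⟩ | ⟨hs, hi⟩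
    · rw [abs_of_pos hi] at h1
      exact mul_pos hs (by linarith [(abs_lt.1 h1).1])
    · rw [abs_of_neg hi] at h1
      exact mul_pos_of_neg_of_neg hs (by linarith [(abs_lt.1 h1).2])
  have hU : IsPreconnected U :=
    ((convex_Ioi (0 : ℝ)).linear_preimage (σ • Complex.imLm)).isPreconnected
  have hu : IsOpen u := Metric.isOpen_iff.2 fun z₀ h₀ => by
    have him : z₀.im ≠ 0 := fun h => by simpa [h] using h₀.1
    exact ⟨|z₀.im|, abs_pos.2 him, fun z hz => hmem z₀ h₀ z (mem_ball_iff_norm.1 hz)⟩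
  have hne : (U ∩ u).Nonempty := by
    have h1 : 0 < σ * (σ * Complex.I).im := by
      simpa using mul_self_pos.2 hσ
    exact ⟨σ * Complex.I, h1, h1, h0⟩
  refine (hU.subset_of_closure_inter_subset hu hne ?_ hz).2
  rintro z ⟨hzc, hzU⟩
  have him : z.im ≠ 0 := fun h => by
    have h1 : 0 < σ * z.im := hzU
    simp [h] at h1
  -- At distance less than `|Im z| / 2` from `z` one has `|Im z₀| > |Im z| / 2`, so the disc about
  -- `z₀` contains `z`.
  obtain ⟨z₀, h₀, hd⟩ := Metric.mem_closure_iff.1 hzc (|z.im| / 2) (by positivity)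
  refine hmem z₀ h₀ z ?_
  rw [dist_eq_norm] at hd
  have h1 := (Complex.abs_im_le_norm (z - z₀)).trans_lt hd
  have h2 := abs_sub_abs_le_abs_sub z.im z₀.im
  rw [Complex.sub_im] at h1
  linarith

/-- The space of solutions in `L²_H(0, ∞)` has dimension at most `n` for all nonreal spectral
parameters. -/
theorem finrank_l2Initial_le_of_deficiencyIndicesEq (hdef : S.IsDefinite) {k : ℕ}
    (hind : S.DeficiencyIndicesEq k) {z : ℂ} (hz : z.im ≠ 0) :
    Module.finrank ℂ (hreg.l2Initial z) ≤ k := by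
  have h : ∀ z, Module.rank ℂ (S.maximalKer z) = k →
      Module.finrank ℂ (hreg.l2Initial z) ≤ k := fun z hk =>
    Module.finrank_le_of_rank_le ((hreg.rank_l2Initial_le hdef z).trans hk.le)
  rcases hz.lt_or_gt with hz | hz
  · exact hreg.finrank_l2Initial_le_of_im_pos hdef (σ := -1) (by norm_num)
      (by
        rw [show ((-1 : ℝ) : ℂ) * Complex.I = -Complex.I by simp]
        exact h _ hind.2) (by linarith)
  · exact hreg.finrank_l2Initial_le_of_im_pos hdef (σ := 1) (by norm_num)
      (by
        rw [Complex.ofReal_one, one_mul]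
        exact h _ hind.1) (by linarith)

end RegularAtZero

end HalfLineSystem

/-! ### Holomorphic matrix functions -/

theorem Differentiable.matrix_det {ι : Type*} [Fintype ι] [DecidableEq ι] {A : ℂ → Matrix ι ι ℂ}
    (hA : ∀ i j, Differentiable ℂ fun z => A z i j) : Differentiable ℂ fun z => (A z).det := by
  simp only [det_apply']
  exact Differentiable.fun_sum fun σ _ => Differentiable.const_mul
    (fun z => DifferentiableAt.fun_finsetProd fun i _ => hA _ _ z) _

theorem Differentiable.matrix_adjugate {ι : Type*} [Fintype ι] [DecidableEq ι]
    {A : ℂ → Matrix ι ι ℂ} (hA : ∀ i j, Differentiable ℂ fun z => A z i j) (i j : ι) :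
    Differentiable ℂ fun z => (A z).adjugate i j := by
  simp only [adjugate_apply]
  refine Differentiable.matrix_det fun k l => ?_
  rcases eq_or_ne k j with rfl | hk
  · simp only [updateRow_self]
    exact differentiable_const _
  · simp only [updateRow_ne hk]
    exact hA k l

theorem DifferentiableOn.matrix_inv {ι : Type*} [Fintype ι] [DecidableEq ι] {A : ℂ → Matrix ι ι ℂ}
    (hA : ∀ i j, Differentiable ℂ fun z => A z i j) {s : Set ℂ} (hs : ∀ z ∈ s, (A z).det ≠ 0)
    (i j : ι) : DifferentiableOn ℂ (fun z => (A z)⁻¹ i j) s := by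
  simp only [inv_def, Ring.inverse_eq_inv', Matrix.smul_apply, smul_eq_mul]
  exact ((Differentiable.matrix_det hA).differentiableOn.inv hs).mul
    (Differentiable.matrix_adjugate hA i j).differentiableOn

theorem Differentiable.matrix_mul {l m k : Type*} [Fintype m] {A : ℂ → Matrix l m ℂ}
    {B : ℂ → Matrix m k ℂ} (hA : ∀ i j, Differentiable ℂ fun z => A z i j)
    (hB : ∀ i j, Differentiable ℂ fun z => B z i j) (i : l) (j : k) :
    Differentiable ℂ fun z => (A z * B z) i j := by
  simp only [mul_apply]
  exact Differentiable.fun_sum fun r _ => (hA i r).mul (hB r j)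

/-! ### Weyl matrices on finite intervals and on the half line -/

namespace HalfLineSystem

variable {n : ℕ} {S : HalfLineSystem n}

theorem mem_preL2_congr {f g : ℝ → Phase n} (hf : f ∈ S.preL2) (h : EqOn f g (Ioi 0)) :
    g ∈ S.preL2 := by
  refine ⟨hf.1.congr ((ae_restrict_iff' measurableSet_Ioi).2 (ae_of_all _ h)), ?_⟩
  refine lt_of_le_of_lt (le_of_eq ?_) hf.2
  refine setLIntegral_congr_fun measurableSet_Ioi fun x hx => ?_
  rw [energyDensity, energyDensity, h hx]

section Boundary

variable {α : Matrix (Fin n) (Fin n ⊕ Fin n) ℂ}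

/-- The initial value of `v + u M`. -/
noncomputable def weylInit (α : Matrix (Fin n) (Fin n ⊕ Fin n) ℂ) (M : Matrix (Fin n) (Fin n) ℂ) :
    Matrix (Fin n ⊕ Fin n) (Fin n) ℂ :=
  αᴴ + -(Matrix.J (Fin n) ℂ * αᴴ) * M

theorem mul_J_mul_J_mul {l k : Type*} (A : Matrix l (Fin n ⊕ Fin n) ℂ)
    (B : Matrix (Fin n ⊕ Fin n) k ℂ) :
    A * Matrix.J (Fin n) ℂ * (Matrix.J (Fin n) ℂ * B) = -(A * B) := by
  rw [Matrix.mul_assoc, ← Matrix.mul_assoc (Matrix.J (Fin n) ℂ), J_squared, Matrix.neg_mul,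
    Matrix.one_mul, Matrix.mul_neg]

theorem mul_weylInit (hα : α * αᴴ = 1) (hαJ : α * Matrix.J (Fin n) ℂ * αᴴ = 0)
    (M : Matrix (Fin n) (Fin n) ℂ) : α * weylInit α M = 1 := by
  rw [weylInit, Matrix.mul_add, hα, ← Matrix.mul_assoc, Matrix.mul_neg, ← Matrix.mul_assoc, hαJ,
    neg_zero, Matrix.zero_mul, add_zero]

/-- Recovers `M` from the initial values; this both bounds `M` by them and shows that they determine
`M`. -/
theorem mul_J_mul_weylInit (hα : α * αᴴ = 1) (hαJ : α * Matrix.J (Fin n) ℂ * αᴴ = 0)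
    (M : Matrix (Fin n) (Fin n) ℂ) : α * Matrix.J (Fin n) ℂ * weylInit α M = M := by
  rw [weylInit, Matrix.mul_add, hαJ, zero_add, ← Matrix.mul_assoc, Matrix.mul_neg,
    mul_J_mul_J_mul, hα, neg_neg, Matrix.one_mul]

theorem conjTranspose_J_mul : (-(Matrix.J (Fin n) ℂ * αᴴ))ᴴ = α * Matrix.J (Fin n) ℂ := by
  rw [conjTranspose_neg, conjTranspose_mul, conjTranspose_conjTranspose, conjTranspose_J,
    Matrix.mul_neg, neg_neg]

theorem conjTranspose_weylInit_mul (hα : α * αᴴ = 1) (hαJ : α * Matrix.J (Fin n) ℂ * αᴴ = 0)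
    (M : Matrix (Fin n) (Fin n) ℂ) :
    (weylInit α M)ᴴ * (Matrix.J (Fin n) ℂ * weylInit α M) = M - Mᴴ := by
  conv_lhs => rw [show (weylInit α M)ᴴ = α + Mᴴ * (α * Matrix.J (Fin n) ℂ) by
    rw [weylInit, conjTranspose_add, conjTranspose_mul, conjTranspose_J_mul,
      conjTranspose_conjTranspose]]
  rw [Matrix.add_mul, ← Matrix.mul_assoc, mul_J_mul_weylInit hα hαJ, Matrix.mul_assoc Mᴴ,
    mul_J_mul_J_mul, mul_weylInit hα hαJ, Matrix.mul_neg, Matrix.mul_one, sub_eq_add_neg]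

theorem bracket_col_weylInit (hα : α * αᴴ = 1) (hαJ : α * Matrix.J (Fin n) ℂ * αᴴ = 0)
    (M : Matrix (Fin n) (Fin n) ℂ) (j : Fin n) :
    bracket ((weylInit α M).col j) ((weylInit α M).col j) = M j j - star (M j j) :=
  congrFun (congrFun (conjTranspose_weylInit_mul hα hαJ M) j) j

/-- `α` and `α J` are the blocks of a unitary matrix. -/
theorem conjTranspose_mul_add (hα : α * αᴴ = 1) (hαJ : α * Matrix.J (Fin n) ℂ * αᴴ = 0) :
    αᴴ * α + (α * Matrix.J (Fin n) ℂ)ᴴ * (α * Matrix.J (Fin n) ℂ) = 1 := by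
  have h1 : (α * Matrix.J (Fin n) ℂ)ᴴ = -(Matrix.J (Fin n) ℂ * αᴴ) := by
    rw [← conjTranspose_J_mul, conjTranspose_conjTranspose]
  rw [← fromCols_mul_fromRows, mul_eq_one_comm, fromRows_mul_fromCols, hα, hαJ, h1,
    Matrix.mul_neg, Matrix.mul_neg, ← Matrix.mul_assoc, hαJ, mul_J_mul_J_mul, hα, neg_neg, neg_zero,
    fromBlocks_one]

/-- The kernel of `α` is isotropic for the symplectic form. -/
theorem bracket_self_eq_zero (hα : α * αᴴ = 1) (hαJ : α * Matrix.J (Fin n) ℂ * αᴴ = 0)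
    {x : Phase n} (hx : α *ᵥ x = 0) : bracket x x = 0 := by
  -- On the kernel of `α` the completeness relation leaves only the `α J` part; a second `J` then
  -- turns it back into `α x = 0`.
  have h1 : x = (α * Matrix.J (Fin n) ℂ)ᴴ *ᵥ ((α * Matrix.J (Fin n) ℂ) *ᵥ x) := by
    have h2 := congrArg (· *ᵥ x) (conjTranspose_mul_add hα hαJ)
    simp only [add_mulVec, one_mulVec, ← mulVec_mulVec, hx, mulVec_zero, zero_add] at h2
    rw [← mulVec_mulVec x α, h2]
  rw [bracket]
  conv_lhs => rw [h1]
  rw [star_mulVec, conjTranspose_conjTranspose, ← dotProduct_mulVec, ← h1, mulVec_mulVec,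
    Matrix.mul_assoc, J_squared, Matrix.mul_neg, Matrix.mul_one, neg_mulVec, hx, neg_zero,
    dotProduct_zero]

end Boundary

namespace RegularAtZero

variable (hreg : S.RegularAtZero) {α : Matrix (Fin n) (Fin n ⊕ Fin n) ℂ}

theorem _root_.HalfLineSystem.solFun_col_add_mul (z : ℂ) (x : ℝ)
    (A B : Matrix (Fin n ⊕ Fin n) (Fin n) ℂ) (M : Matrix (Fin n) (Fin n) ℂ) (j : Fin n) :
    S.solFun z ((A + B * M).col j) x =
      S.solFun z (A.col j) x + ∑ k, M k j • S.solFun z (B.col k) x := by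
  have h : (A + B * M).col j = A.col j + ∑ k, M k j • B.col k := by
    ext i
    simp [mul_apply, mul_comm]
  simp only [h, solFun, map_add, map_sum, map_smul]

include hreg in
-- By uniqueness of solutions, the quantified `u` and `v` may be replaced by the propagator applied
-- to the initial values.
theorem isWeylMatrix_iff {z : ℂ} {M : Matrix (Fin n) (Fin n) ℂ} :
    S.IsWeylMatrix α z M ↔ ∀ j, (weylInit α M).col j ∈ hreg.l2Initial z := by
  have key : ∀ (u v : ℝ → Matrix (Fin n ⊕ Fin n) (Fin n) ℂ) (x : ℝ) (j : Fin n),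
      (∀ k, (fun i => u x i k) = S.solFun z ((-(Matrix.J (Fin n) ℂ * αᴴ)).col k) x) →
      (fun i => v x i j) = S.solFun z (αᴴ.col j) x →
      (fun i => (v x + u x * M) i j) = S.solFun z ((weylInit α M).col j) x := by
    intro u v x j hu hv
    rw [weylInit, S.solFun_col_add_mul, ← hv]
    simp only [← hu]
    ext i
    simp [mul_apply, mul_comm]
  constructor
  · rintro ⟨u, v, ⟨hu0, hu⟩, ⟨hv0, hv⟩, h⟩ j
    refine mem_preL2_congr (h j) fun x hx => key u v x j (fun k => ?_) ?_
    · have h1 := hreg.eq_solFun (z := z) ⟨(hu k).1, (hu k).2⟩ (le_of_lt hx)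
      rw [h1, hu0]
      rfl
    · have h1 := hreg.eq_solFun (z := z) ⟨(hv j).1, (hv j).2⟩ (le_of_lt hx)
      rw [h1, hv0]
      rfl
  · intro h
    let U : Matrix (Fin n ⊕ Fin n) (Fin n) ℂ → ℝ → Matrix (Fin n ⊕ Fin n) (Fin n) ℂ :=
      fun C x => Matrix.of fun i j => S.solFun z (C.col j) x i
    have hms : ∀ C : Matrix (Fin n ⊕ Fin n) (Fin n) ℂ,
        S.IsMatrixSolution z C (U C) := fun C => by
      refine ⟨?_, fun j => ?_⟩
      · ext i j
        change S.solFun z (C.col j) 0 i = C i j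
        rw [S.solFun_zero hreg]
        rfl
      · exact ⟨(S.solves_solFun hreg z (C.col j)).ac, (S.solves_solFun hreg z (C.col j)).ae⟩
    refine ⟨_, _, hms _, hms _, fun j => mem_preL2_congr (h j) fun x _ => ?_⟩
    exact (key (U (-(Matrix.J (Fin n) ℂ * αᴴ))) (U αᴴ) x j (fun k => rfl) rfl).symm

include hreg in
/-- Uniqueness of the Weyl matrix. -/
theorem isWeylMatrix_unique (hα : α * αᴴ = 1) (hαJ : α * Matrix.J (Fin n) ℂ * αᴴ = 0) {z : ℂ}
    (hz : Module.finrank ℂ (hreg.l2Initial z) ≤ n) {M M' : Matrix (Fin n) (Fin n) ℂ}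
    (hM : S.IsWeylMatrix α z M) (hM' : S.IsWeylMatrix α z M') : M' = M := by
  rw [hreg.isWeylMatrix_iff] at hM hM'
  have hmem : ∀ c, (weylInit α M).mulVecLin c ∈ hreg.l2Initial z := fun c => by
    have h1 : (weylInit α M).mulVecLin c = ∑ j, c j • (weylInit α M).col j := by
      ext i
      simp [mulVec, dotProduct, mul_comm]
    rw [h1]
    exact Submodule.sum_mem _ fun j _ => Submodule.smul_mem _ _ (hM j)
  let Γ : (Fin n → ℂ) →ₗ[ℂ] hreg.l2Initial z := (weylInit α M).mulVecLin.codRestrict _ hmem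
  have hΓ : Function.Injective Γ := (injective_iff_map_eq_zero Γ).2 fun c hc => by
    have h1 : weylInit α M *ᵥ c = 0 := congrArg Subtype.val hc
    have h2 := congrArg (α *ᵥ ·) h1
    simpa only [mulVec_mulVec, mul_weylInit hα hαJ, one_mulVec, mulVec_zero] using h2
  -- The `n` independent columns meet the upper bound on the dimension, so they form a basis.
  have hfr : Module.finrank ℂ (Fin n → ℂ) = Module.finrank ℂ (hreg.l2Initial z) :=
    le_antisymm (LinearMap.finrank_le_finrank_of_injective hΓ) (by simpa using hz)
  have hsurj := (LinearMap.injective_iff_surjective_of_finrank_eq_finrank hfr).1 hΓ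
  have hW : weylInit α M' = weylInit α M := by
    ext i j
    obtain ⟨c, hc⟩ := hsurj ⟨_, hM' j⟩
    have h1 : weylInit α M *ᵥ c = weylInit α M' *ᵥ Pi.single j 1 := by
      rw [mulVec_single_one]
      exact congrArg Subtype.val hc
    have h2 := congrArg (α *ᵥ ·) h1
    simp only [mulVec_mulVec, mul_weylInit hα hαJ, one_mulVec] at h2
    rw [h2, mulVec_single_one, mulVec_single_one] at h1
    exact (congrFun h1 i).symm
  rw [← mul_J_mul_weylInit hα hαJ M', hW, mul_J_mul_weylInit hα hαJ]

/-- The matrix of the propagator. -/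
noncomputable def _root_.HalfLineSystem.propMatrix (S : HalfLineSystem n) (b : ℝ) (z : ℂ) :
    Matrix (Fin n ⊕ Fin n) (Fin n ⊕ Fin n) ℂ :=
  LinearMap.toMatrix' (propagator S.coeff z b).toLinearMap

theorem _root_.HalfLineSystem.propMatrix_mulVec (b : ℝ) (z : ℂ) (w : Phase n) :
    S.propMatrix b z *ᵥ w = S.solFun z w b :=
  LinearMap.toMatrix'_mulVec _ _

include hreg in
theorem differentiable_propMatrix {b : ℝ} (hb : 0 ≤ b) (i j : Fin n ⊕ Fin n) :
    Differentiable ℂ fun z => S.propMatrix b z i j := by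
  have h : ∀ z, S.propMatrix b z i j = propagator S.coeff z b (Pi.single j 1) i := fun z => by
    rw [propMatrix, LinearMap.toMatrix'_apply]
    rfl
  simp only [h]
  exact fun z => differentiableAt_pi.1 (((differentiable_propagator
    (S.intervalIntegrable_coeff hreg) hb) z).clm_apply (differentiableAt_const _)) i

/-- The denominator of the Weyl function of the problem on `[0, b]`. -/
noncomputable def _root_.HalfLineSystem.weylDenom (S : HalfLineSystem n)
    (α : Matrix (Fin n) (Fin n ⊕ Fin n) ℂ) (b : ℝ) (z : ℂ) : Matrix (Fin n) (Fin n) ℂ :=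
  α * S.propMatrix b z * -(Matrix.J (Fin n) ℂ * αᴴ)

/-- The Weyl function of the problem on `[0, b]` with the boundary condition `α y(b) = 0`. -/
noncomputable def _root_.HalfLineSystem.finiteWeyl (S : HalfLineSystem n)
    (α : Matrix (Fin n) (Fin n ⊕ Fin n) ℂ) (b : ℝ) (z : ℂ) : Matrix (Fin n) (Fin n) ℂ :=
  -((S.weylDenom α b z)⁻¹ * (α * S.propMatrix b z * αᴴ))

include hreg in
-- The boundary term at `b` in the Lagrange identity vanishes because the kernel of `α` is
-- isotropic.
theorem im_mul_nsq_trunc_sol (hα : α * αᴴ = 1) (hαJ : α * Matrix.J (Fin n) ℂ * αᴴ = 0) {b : ℝ}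
    (hb : 0 ≤ b) {z : ℂ} {w : Phase n} (hw : α *ᵥ S.solFun z w b = 0) :
    bracket w w = 2 * (z.im * S.nsq (S.trunc b (hreg.sol z w)) : ℝ) * Complex.I := by
  have h := hreg.lagrange_sol z z w w hb
  have h1 : bracket ((hreg.sol z w).1 b) ((hreg.sol z w).1 b) = 0 :=
    bracket_self_eq_zero hα hαJ hw
  have h2 : star z - z = -(2 * z.im * Complex.I) := by
    rw [← neg_sub, Complex.star_def, Complex.sub_conj]
    push_cast
    ring
  rw [h1, ip_self, h2] at h
  push_cast
  linear_combination -h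

include hreg in
-- A kernel vector yields a solution satisfying the condition `α y = 0` at both ends. Both boundary
-- terms vanish, so its norm is zero when `z` is nonreal.
theorem det_weylDenom_ne_zero (hα : α * αᴴ = 1) (hαJ : α * Matrix.J (Fin n) ℂ * αᴴ = 0) {b : ℝ}
    (hb : 0 ≤ b) (hbdef : ∀ w : Phase n,
      (∀ᵐ x ∂volume.restrict (Ioc (0 : ℝ) b), S.H x *ᵥ w = 0) → w = 0) {z : ℂ} (hz : z.im ≠ 0) :
    (S.weylDenom α b z).det ≠ 0 := by
  intro h0
  obtain ⟨c, hc0, hc⟩ := exists_mulVec_eq_zero_iff.2 h0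
  refine hc0 ?_
  set w : Phase n := -(Matrix.J (Fin n) ℂ * αᴴ) *ᵥ c with hw
  have h1 : α *ᵥ S.solFun z w b = 0 := by
    rw [← S.propMatrix_mulVec, mulVec_mulVec, hw, mulVec_mulVec]
    exact hc
  have h2 := hreg.im_mul_nsq_trunc_sol hα hαJ hb h1
  have h3 : α *ᵥ w = 0 := by
    rw [hw, mulVec_mulVec, Matrix.mul_neg, ← Matrix.mul_assoc, hαJ, neg_zero, zero_mulVec]
  rw [bracket_self_eq_zero hα hαJ h3] at h2
  have h4 : S.nsq (S.trunc b (hreg.sol z w)) = 0 := by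
    have h5 := congrArg Complex.im h2
    simpa [hz] using h5
  have h5 := hreg.eq_zero_of_nsq_trunc_eq_zero hbdef h4
  have h6 : (α * Matrix.J (Fin n) ℂ) *ᵥ w = c := by
    rw [hw, mulVec_mulVec, Matrix.mul_neg, mul_J_mul_J_mul, hα, neg_neg, one_mulVec]
  rw [← h6, h5, mulVec_zero]

include hreg in
/-- Bounds for the Weyl functions of finite intervals. -/
theorem finiteWeyl_bounds (hα : α * αᴴ = 1) (hαJ : α * Matrix.J (Fin n) ℂ * αᴴ = 0) :
    ∃ A : ℝ, ∀ N b : ℝ, 0 ≤ N → N ≤ b → (∀ w : Phase n,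
      (∀ᵐ x ∂volume.restrict (Ioc (0 : ℝ) N), S.H x *ᵥ w = 0) → w = 0) → ∀ z : ℂ, z.im ≠ 0 →
      ∀ δ : ℝ, 0 < δ → (∀ w : Phase n, δ * ‖w‖ ^ 2 ≤ S.nsq (S.trunc N (hreg.sol z w))) →
      (∀ i j, ‖S.finiteWeyl α b z i j‖ ≤ A ^ 2 / (δ * |z.im|)) ∧
      ∀ j, S.nsq (S.trunc b (hreg.sol z ((weylInit α (S.finiteWeyl α b z)).col j))) ≤
        A ^ 2 / (δ * |z.im|) / |z.im| := by
  let L : Phase n →L[ℂ] (Fin n → ℂ) :=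
    LinearMap.toContinuousLinearMap (α * Matrix.J (Fin n) ℂ).mulVecLin
  refine ⟨‖L‖, fun N b hN hNb hNdef z hz δ hδ hδw => ?_⟩
  have hb : 0 ≤ b := hN.trans hNb
  have hdet := hreg.det_weylDenom_ne_zero hα hαJ hb (fun w hw => hNdef w
    (ae_restrict_of_ae_restrict_of_subset (Ioc_subset_Ioc_right hNb) hw)) hz
  set M := S.finiteWeyl α b z with hM
  -- `finiteWeyl` is defined so that `v + u M` satisfies the boundary condition at `b`.
  have hbc : α * S.propMatrix b z * weylInit α M = 0 := by
    rw [weylInit, Matrix.mul_add, ← Matrix.mul_assoc, hM, finiteWeyl, Matrix.mul_neg,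
      ← Matrix.mul_assoc, ← weylDenom, mul_nonsing_inv _ (isUnit_iff_ne_zero.2 hdet),
      Matrix.one_mul, add_neg_cancel]
  have hz' : 0 < |z.im| := abs_pos.2 hz
  have key : ∀ j, |z.im| * S.nsq (S.trunc b (hreg.sol z ((weylInit α M).col j))) ≤ ‖M j j‖ := by
    intro j
    have h1 : α *ᵥ S.solFun z ((weylInit α M).col j) b = 0 := by
      rw [← S.propMatrix_mulVec, mulVec_mulVec, ← mulVec_single_one, mulVec_mulVec, hbc,
        zero_mulVec]
    have h2 := hreg.im_mul_nsq_trunc_sol hα hαJ hb h1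
    rw [bracket_col_weylInit hα hαJ] at h2
    have h3 := congrArg Complex.im h2
    have h4 : z.im * S.nsq (S.trunc b (hreg.sol z ((weylInit α M).col j))) = (M j j).im := by
      simp at h3
      linarith
    rw [← abs_of_nonneg (S.nsq_nonneg (S.trunc b (hreg.sol z ((weylInit α M).col j)))), ← abs_mul,
      h4]
    exact Complex.abs_im_le_norm _
  have hcol : ∀ i j, ‖M i j‖ ≤ ‖L‖ * ‖(weylInit α M).col j‖ := fun i j => by
    refine le_trans ?_ (L.le_opNorm _)
    have h1 : L ((weylInit α M).col j) = M.col j := by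
      change (α * Matrix.J (Fin n) ℂ) *ᵥ (weylInit α M).col j = M.col j
      rw [← mulVec_single_one, mulVec_mulVec, mul_J_mul_weylInit hα hαJ, mulVec_single_one]
    rw [h1]
    exact norm_le_pi_norm (M.col j) i
  -- Quadratic growth of the norm in `w` against the linear bound for `M`: dividing by `‖w‖` bounds
  -- `w` independently of `b`.
  have hw : ∀ j, ‖(weylInit α M).col j‖ ≤ ‖L‖ / (δ * |z.im|) := fun j => by
    set w := (weylInit α M).col j
    rw [le_div_iff₀ (by positivity)]
    rcases (norm_nonneg w).eq_or_lt with h0 | h0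
    · rw [← h0, zero_mul]
      exact norm_nonneg _
    refine le_of_mul_le_mul_right ?_ h0
    calc ‖w‖ * (δ * |z.im|) * ‖w‖ = |z.im| * (δ * ‖w‖ ^ 2) := by ring
      _ ≤ |z.im| * S.nsq (S.trunc b (hreg.sol z w)) := by
        gcongr
        exact (hδw w).trans (S.nsq_trunc_mono _ hNb)
      _ ≤ _ := (key j).trans (hcol j j)
  have hbound : ∀ i j, ‖M i j‖ ≤ ‖L‖ ^ 2 / (δ * |z.im|) := fun i j => by
    refine (hcol i j).trans ((mul_le_mul_of_nonneg_left (hw j) (norm_nonneg _)).trans_eq ?_)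
    ring
  refine ⟨hbound, fun j => ?_⟩
  rw [le_div_iff₀ hz', mul_comm]
  exact (key j).trans (hbound j j)

open Filter Topology in
include hreg in
/-- Cluster points of the Weyl functions of finite intervals are Weyl matrices. -/
theorem isWeylMatrix_of_mapClusterPt {z : ℂ} {N : ℕ} {C : ℝ}
    (hC : ∀ (k : ℕ) j, S.nsq (S.trunc ((k + N : ℕ) : ℝ) (hreg.sol z
      ((weylInit α (S.finiteWeyl α ((k + N : ℕ) : ℝ) z)).col j))) ≤ C)
    {M : Fin n → Fin n → ℂ}
    (hM : MapClusterPt M atTop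
      fun k : ℕ => (S.finiteWeyl α ((k + N : ℕ) : ℝ) z : Fin n → Fin n → ℂ)) :
    S.IsWeylMatrix α z M := by
  obtain ⟨ψ, hψ, hlim⟩ := hM.tendsto_subseq
  refine hreg.isWeylMatrix_iff.2 fun j => ?_
  refine S.mem_preL2_of_nsq_trunc_le (hreg.sol z _) (C := C) fun m => ?_
  have hcont : Continuous fun M : Matrix (Fin n) (Fin n) ℂ => (weylInit α M).col j := by
    unfold weylInit
    exact continuous_pi fun i => (continuous_const.add
      (continuous_const.matrix_mul continuous_id)).matrix_elem i j
  refine le_of_tendsto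
    (((hreg.continuous_nsq_trunc_sol_right m z).comp hcont).continuousAt.tendsto.comp hlim) ?_
  -- For fixed `m` the interval `(0, m]` eventually lies inside the intervals on which `C` is a
  -- bound.
  filter_upwards [hψ.tendsto_atTop.eventually_ge_atTop m] with k hk
  exact (S.nsq_trunc_mono _ (by exact_mod_cast hk.trans (Nat.le_add_right _ _))).trans (hC (ψ k) j)

open Filter Topology in
include hreg in
/-- Existence of the Weyl matrix, and its approximation by the Weyl functions of finite
intervals. -/
theorem exists_isWeylMatrix_tendsto (hα : α * αᴴ = 1) (hαJ : α * Matrix.J (Fin n) ℂ * αᴴ = 0)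
    {N : ℕ} (hN : ∀ w : Phase n,
      (∀ᵐ x ∂volume.restrict (Ioc (0 : ℝ) N), S.H x *ᵥ w = 0) → w = 0) {z : ℂ} (hz : z.im ≠ 0)
    (hfr : Module.finrank ℂ (hreg.l2Initial z) ≤ n) :
    ∃ M : Fin n → Fin n → ℂ, S.IsWeylMatrix α z M ∧ Tendsto
      (fun k : ℕ => (S.finiteWeyl α ((k + N : ℕ) : ℝ) z : Fin n → Fin n → ℂ)) atTop (𝓝 M) := by
  obtain ⟨A, hA⟩ := hreg.finiteWeyl_bounds hα hαJ
  obtain ⟨δ, hδ, hδw⟩ := hreg.exists_le_nsq_trunc_sol hN (isCompact_singleton (x := z))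
  have hb := fun k : ℕ => hA N ((k + N : ℕ) : ℝ) N.cast_nonneg
    (by exact_mod_cast Nat.le_add_left N k) hN z hz δ hδ (hδw z rfl)
  set R := A ^ 2 / (δ * |z.im|)
  have hK : IsCompact (univ.pi fun _ : Fin n => univ.pi fun _ : Fin n =>
      Metric.closedBall (0 : ℂ) R) :=
    isCompact_univ_pi fun _ => isCompact_univ_pi fun _ => isCompact_closedBall _ _
  have hmem : ∀ k : ℕ, (S.finiteWeyl α ((k + N : ℕ) : ℝ) z : Fin n → Fin n → ℂ) ∈
      (univ.pi fun _ : Fin n => univ.pi fun _ : Fin n => Metric.closedBall (0 : ℂ) R) :=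
    fun k i _ j _ => mem_closedBall_zero_iff.2 ((hb k).1 i j)
  have hcl : ∀ M : Fin n → Fin n → ℂ, MapClusterPt M atTop
      (fun k : ℕ => (S.finiteWeyl α ((k + N : ℕ) : ℝ) z : Fin n → Fin n → ℂ)) →
      S.IsWeylMatrix α z M := fun M hM =>
    hreg.isWeylMatrix_of_mapClusterPt (fun k j => (hb k).2 j) hM
  obtain ⟨M, -, hM⟩ := hK.exists_mapClusterPt (f := atTop)
    (tendsto_principal.2 (Eventually.of_forall hmem))
  -- In a compact set, a sequence with only one cluster point converges.
  exact ⟨M, hcl M hM, hK.tendsto_nhds_of_unique_mapClusterPt (Eventually.of_forall hmem)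
    fun M' _ hM' => hreg.isWeylMatrix_unique hα hαJ hfr (hcl M hM) (hcl M' hM')⟩

include hreg in
theorem differentiableOn_finiteWeyl (hα : α * αᴴ = 1)
    (hαJ : α * Matrix.J (Fin n) ℂ * αᴴ = 0) {b : ℝ} (hb : 0 ≤ b) (hbdef : ∀ w : Phase n,
      (∀ᵐ x ∂volume.restrict (Ioc (0 : ℝ) b), S.H x *ᵥ w = 0) → w = 0) (i j : Fin n) :
    DifferentiableOn ℂ (fun z => S.finiteWeyl α b z i j) {z | z.im ≠ 0} := by
  have hP := hreg.differentiable_propMatrix hb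
  have hc : ∀ {l m : Type} (C : Matrix l m ℂ) (i : l) (j : m),
      Differentiable ℂ fun _ : ℂ => C i j :=
    fun C i j => differentiable_const _
  have hαP := Differentiable.matrix_mul (hc α) hP
  have hD : ∀ i j, Differentiable ℂ fun z => S.weylDenom α b z i j :=
    Differentiable.matrix_mul hαP (hc _)
  have hV := Differentiable.matrix_mul hαP (hc αᴴ)
  simp only [finiteWeyl, Matrix.neg_apply, mul_apply (M := (S.weylDenom α b _)⁻¹)]
  exact (DifferentiableOn.fun_sum fun k _ => (DifferentiableOn.matrix_inv hD
    (fun z hz => hreg.det_weylDenom_ne_zero hα hαJ hb hbdef hz) i k).mul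
      (hV k j).differentiableOn).neg

end RegularAtZero

end HalfLineSystem

open Filter Topology in
theorem mainTheorem12 (n : ℕ) (S : HalfLineSystem n)
    (hreg : S.RegularAtZero) (hdef : S.IsDefinite) (hind : S.DeficiencyIndicesEq n)
    (α : Matrix (Fin n) (Fin n ⊕ Fin n) ℂ)
    (hα : α * αᴴ = 1) (hαJ : α * Matrix.J (Fin n) ℂ * αᴴ = 0) :
    (∀ z : ℂ, z.im ≠ 0 → ∃! M : Matrix (Fin n) (Fin n) ℂ, S.IsWeylMatrix α z M) ∧
    ∀ i j : Fin n, DifferentiableOn ℂ (fun z => S.weylM α z i j) {z : ℂ | z.im ≠ 0} := by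
  have hfr : ∀ z : ℂ, z.im ≠ 0 → Module.finrank ℂ (hreg.l2Initial z) ≤ n := fun z hz =>
    hreg.finrank_l2Initial_le_of_deficiencyIndicesEq hdef hind hz
  obtain ⟨N, hN⟩ := hdef.exists_nat
  have hex := fun z (hz : z.im ≠ 0) => hreg.exists_isWeylMatrix_tendsto hα hαJ hN hz (hfr z hz)
  refine ⟨fun z hz => ?_, fun i j => ?_⟩
  · obtain ⟨M, hM, -⟩ := hex z hz
    exact ⟨M, hM, fun M' hM' => hreg.isWeylMatrix_unique hα hαJ (hfr z hz) hM hM'⟩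
  have hlim : ∀ z : ℂ, z.im ≠ 0 → Tendsto (fun k : ℕ => S.finiteWeyl α ((k + N : ℕ) : ℝ) z i j)
      atTop (𝓝 (S.weylM α z i j)) := fun z hz => by
    obtain ⟨M, hM, hlim⟩ := hex z hz
    have h1 : ∃ M, S.IsWeylMatrix α z M := ⟨M, hM⟩
    -- `weylM` is an arbitrary choice, identified with the limit by uniqueness.
    have h2 : S.weylM α z = M := by
      rw [HalfLineSystem.weylM, dif_pos h1]
      exact hreg.isWeylMatrix_unique hα hαJ (hfr z hz) hM h1.choose_spec
    rw [h2]
    exact tendsto_pi_nhds.1 (tendsto_pi_nhds.1 hlim i) j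
  intro z hz
  have hz' : 0 < |z.im| := abs_pos.2 hz
  -- Half the distance to the real axis as radius bounds `|Im w|` below on the disc, so one constant
  -- serves all `k` and `w`.
  have him : ∀ w ∈ Metric.closedBall z (|z.im| / 2), |z.im| / 2 ≤ |w.im| := fun w hw => by
    have h1 := (Complex.abs_im_le_norm (z - w)).trans (mem_closedBall_iff_norm'.1 hw)
    have h2 := abs_sub_abs_le_abs_sub z.im w.im
    rw [Complex.sub_im] at h1
    linarith
  have hne : ∀ w ∈ Metric.closedBall z (|z.im| / 2), w.im ≠ 0 := fun w hw =>
    abs_pos.1 ((half_pos hz').trans_le (him w hw))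
  obtain ⟨A, hA⟩ := hreg.finiteWeyl_bounds hα hαJ
  obtain ⟨δ, hδ, hδw⟩ := hreg.exists_le_nsq_trunc_sol hN
    (isCompact_closedBall z (|z.im| / 2))
  have hNk : ∀ k : ℕ, (N : ℝ) ≤ ((k + N : ℕ) : ℝ) := fun k => by
    exact_mod_cast Nat.le_add_left N k
  refine ((differentiableOn_ball_of_tendsto_of_bounded (half_pos hz')
    (C := A ^ 2 / (δ * (|z.im| / 2))) (fun k => ?_) (fun k w hw => ?_) fun w hw =>
      hlim w (hne w hw)).differentiableAt
        (Metric.ball_mem_nhds z (half_pos hz'))).differentiableWithinAt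
  · exact (hreg.differentiableOn_finiteWeyl hα hαJ (Nat.cast_nonneg (k + N)) (fun w hw => hN w
      (ae_restrict_of_ae_restrict_of_subset (Ioc_subset_Ioc_right (hNk k)) hw)) i j).mono hne
  · refine ((hA N _ N.cast_nonneg (hNk k) hN w (hne w hw) δ hδ (hδw w hw)).1 i j).trans ?_
    gcongr
    exact him w hw
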